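/- Let $m\ge 2$ be an integer, $0<a\le\frac14$, $\alpha>0$, and $r_i=a\,i^{-\alpha}$ for $i=1,2,\dots$. Let $(z_i)_{i\ge1}$ be an enumeration of $\mathbb{Z}^m$ (each point listed exactly once), and let $\Omega=\bigcup_{i\ge1}B(z_i;r_i)\subset\mathbb{R}^m$, where $B(z;r)$ is the open Euclidean ball with centre $z$ and radius $r$. For $t>0$ let $$H_\Omega(t)=\int_\Omega dx\int_\Omega dy\,(4\pi t)^{-m/2}e^{-|x-y|^2/(4t)}\in[0,\infty],$$ and, if the Lebesgue measure $|\Omega|$ is finite, $F_\Omega(t)=|\Omega|-H_\Omega(t)$. Let $\mathrm{Per}(\Omega)=\sup\{\int_\Omega \operatorname{div}\varphi\,dx:\varphi\in C_c^1(\mathbb{R}^m;\mathbb{R}^m),\ |\varphi|\le1\}$ be the perimeter of $\Omega$. All asymptotic statements are for $t\downarrow0$, with $m,a,\alpha,(z_i)$ fixed. (1) If $\frac1{2m}<\alpha<\frac1m$, then $H_\Omega(t)<\infty$ for all $t>0$ and $$H_\Omega(t)=c_{\alpha,m}\,t^{(m\alpha-1)/(2\alpha)}+O(1),$$ where $$c_{\alpha,m}=2^{m-1-\frac1\alpha}\pi^{-m/2}\alpha^{-1}\,\Gamma\Big(\frac{2m\alpha-1}{2\alpha}\Big)a^{1/\alpha}\int_{B(0;1)}dx\int_{B(0;1)}dy\,|x-y|^{(1-2m\alpha)/\alpha}<\infty.$$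 (2) If $\frac1m<\alpha<\frac1{m-1}$, then $|\Omega|<\infty$ and $$F_\Omega(t)=d_{\alpha,m}\,t^{(m\alpha-1)/(2\alpha)}+O(t^{1/2}),$$ where $$d_{\alpha,m}=2^{m-1-\frac1\alpha}\pi^{-m/2}\alpha^{-1}\,\Gamma\Big(\frac{2m\alpha-1}{2\alpha}\Big)a^{1/\alpha}\int_{B(0;1)}dx\int_{\mathbb{R}^m\setminus B(0;1)}dy\,|x-y|^{(1-2m\alpha)/\alpha}<\infty.$$ (3) If $m>2$ and $\frac1{m-1}<\alpha<\frac1{m-2}$, or if $m=2$ and $\alpha>\frac1{m-1}=1$, then $|\Omega|<\infty$, $\mathrm{Per}(\Omega)<\infty$ and $$F_\Omega(t)=\pi^{-1/2}\,\mathrm{Per}(\Omega)\,t^{1/2}+O\big(t^{(m\alpha-1)/(2\alpha)}\big).$$ (4) If $m>2$ and $\alpha=\frac1{m-2}$, then $|\Omega|<\infty$, $\mathrm{Per}(\Omega)<\infty$ and $$F_\Omega(t)=\pi^{-1/2}\,\mathrm{Per}(\Omega)\,t^{1/2}+O\Big(t\log\frac1t\Big).$$ (5) If $m>2$ and $\alpha>\frac1{m-2}$,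 then $|\Omega|<\infty$, $\mathrm{Per}(\Omega)<\infty$ and $$F_\Omega(t)=\pi^{-1/2}\,\mathrm{Per}(\Omega)\,t^{1/2}+O(t).$$ -/

import Mathlib

open MeasureTheory Filter Topology Asymptotics
open scoped ENNReal

noncomputable section

namespace HeatContent

/-- Euclidean space of dimension `m`. -/
abbrev E (m : ℕ) : Type := EuclideanSpace ℝ (Fin m)

/-- The heat kernel of `ℝ^m`: `(4πt)^{-m/2} exp(-|x-y|²/(4t))`. -/
def heatKernel {m : ℕ} (x y : E m) (t : ℝ) : ℝ :=
  (4 * Real.pi * t) ^ (-(m : ℝ) / 2) * Real.exp (-‖x - y‖ ^ 2 / (4 * t))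

/-- The heat content `H_Ω(t) = ∫_Ω dx ∫_Ω dy p(x,y;t)`, with values in `[0,∞]`. -/
def heatContent {m : ℕ} (Ω : Set (E m)) (t : ℝ) : ℝ≥0∞ :=
  ∫⁻ x in Ω, ∫⁻ y in Ω, ENNReal.ofReal (heatKernel x y t)

/-- The heat loss `F_Ω(t) = |Ω| - H_Ω(t)`; meaningful when `Ω` has finite measure. -/
def heatLoss {m : ℕ} (Ω : Set (E m)) (t : ℝ) : ℝ :=
  (volume Ω).toReal - (heatContent Ω t).toReal

/-- The divergence of a vector field. -/
def divergence {m : ℕ} (φ : E m → E m) (x : E m) : ℝ :=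
  ∑ i : Fin m, (fderiv ℝ φ x (EuclideanSpace.single i 1)) i

/-- The (De Giorgi) perimeter of a measurable set, with values in `[0,∞]`: the supremum of
`∫_A div φ` over all compactly supported `C¹` vector fields `φ` with `|φ| ≤ 1`. -/
def perimeter {m : ℕ} (A : Set (E m)) : ℝ≥0∞ :=
  ⨆ (φ : E m → E m) (_ : ContDiff ℝ 1 φ) (_ : HasCompactSupport φ) (_ : ∀ x, ‖φ x‖ ≤ 1),
    ENNReal.ofReal (∫ x in A, divergence φ x)

/-- A point of `ℤ^m`, seen in `ℝ^m`. -/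
def latticePoint {m : ℕ} (k : Fin m → ℤ) : E m := WithLp.toLp 2 (fun j => (k j : ℝ))

/-- The union over `i = 1, 2, …` of the open balls with centre `z_i` and radius `a i^{-α}`,
where `z` enumerates `ℤ^m`. -/
def ballUnion {m : ℕ} (a α : ℝ) (z : ℕ+ ≃ (Fin m → ℤ)) : Set (E m) :=
  ⋃ i : ℕ+, Metric.ball (latticePoint (z i)) (a * ((i : ℕ) : ℝ) ^ (-α))

/-- `∫_A dx ∫_B dy |x-y|^p`, with values in `[0,∞]`. -/
def doubleIntegral {m : ℕ} (A B : Set (E m)) (p : ℝ) : ℝ≥0∞ :=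
  ∫⁻ x in A, ∫⁻ y in B, ENNReal.ofReal (‖x - y‖ ^ p)

/-- The double integral over `B(0;1) × B(0;1)` in the constant `c_{α,m}`. -/
def innerIntegral (m : ℕ) (α : ℝ) : ℝ≥0∞ :=
  doubleIntegral (Metric.ball (0 : E m) 1) (Metric.ball (0 : E m) 1) ((1 - 2 * m * α) / α)

/-- The double integral over `B(0;1) × (ℝ^m - B(0;1))` in the constant `d_{α,m}`. -/
def outerIntegral (m : ℕ) (α : ℝ) : ℝ≥0∞ :=
  doubleIntegral (Metric.ball (0 : E m) 1) (Metric.ball (0 : E m) 1)ᶜ ((1 - 2 * m * α) / α)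

/-- The factor `2^{m-1-1/α} π^{-m/2} α^{-1} Γ((2mα-1)/(2α)) a^{1/α}`. -/
def prefactor (m : ℕ) (a α : ℝ) : ℝ :=
  (2 : ℝ) ^ ((m : ℝ) - 1 - 1 / α) * Real.pi ^ (-(m : ℝ) / 2) * α⁻¹
    * Real.Gamma ((2 * m * α - 1) / (2 * α)) * a ^ (1 / α)

/-- The constant `c_{α,m}`. -/
def cConst (m : ℕ) (a α : ℝ) : ℝ := prefactor m a α * (innerIntegral m α).toReal

/-- The constant `d_{α,m}`. -/
def dConst (m : ℕ) (a α : ℝ) : ℝ := prefactor m a α * (outerIntegral m α).toReal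

end HeatContent

end

open MeasureTheory Filter Topology Asymptotics
open scoped ENNReal

noncomputable section

namespace HeatContent

/-! The balls are pairwise disjoint, so the heat content is the sum of the exchanges of each ball
with itself plus the cross exchange between distinct balls. The cross exchange is `O(t)`
(`exists_crossExchange_le`): centres are at distance `D ≥ 1` and radii are at most `1/4`, so points
of two different balls are at least `D/2` apart, where the kernel is at most a constant times `t *
D^(-(m+2))`. This is summable over the lattice, and the volumes enter only through the sum of their
squares, which is finite as soon as `2mα > 1`. The enumeration therefore plays no role, and
everything reduces to sums of quantities attached to single balls.

In (1) and (2) the summand is the self-exchange or the heat loss of a ball of radius `a s^(-α)` at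
`s = i`. It increases with the radius, hence decreases in `s`, and the sum is compared with the
integral over `(0, ∞)`. Scaling and a Gamma integral evaluate that integral exactly as the stated
power of `t` times the stated constant (`lintegral_exchange_dilated`). The comparison costs only the
value at `1` and the integral over `(0, 1]`. Bounding the summand by the volume of the ball gives
`O(1)` when `mα < 1`; bounding a heat loss by its surface term gives `O(t^(1/2))` when `(m-1)α < 1`.
Finiteness of the double integrals comes out of the same comparison.

In (3)-(5) the loss of one ball is the average, against the kernel, of the volume lost under a
translation by `h`. Slicing along `h`, a chord of length `ℓ` loses `min ‖h‖ ℓ` (`shiftLoss_eq`).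
Replacing this by `‖h‖` gives the perimeter term, through the first moment of the kernel. Only
chords shorter than `‖h‖` produce an error, and these lie near the rim, so one ball contributes an
error of order `min (r^(m-1) t^(1/2)) (r^(m-2) t)`. Summing over the radii, with a split where the
radius is comparable to `t^(1/2)`, produces the three regimes. The perimeter of the union is the sum
of the sphere areas (`perimeter_ballUnion`): cutoffs give the upper bound, explicit radial test
fields the lower one. -/

variable {m : ℕ}

/-! ### Heat kernel: total mass, exchange between sets, decay and second moment -/

/-- The heat kernel as a function of the displacement, with values in `[0,∞]`. -/
def gaussKernel {m : ℕ} (t : ℝ) (h : E m) : ℝ≥0∞ :=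
  ENNReal.ofReal ((4 * Real.pi * t) ^ (-(m : ℝ) / 2) * Real.exp (-‖h‖ ^ 2 / (4 * t)))

/-- The heat exchanged between two sets: `∫_A dx ∫_B dy p(x,y;t)`. -/
def exchange {m : ℕ} (A B : Set (E m)) (t : ℝ) : ℝ≥0∞ :=
  ∫⁻ x in A, ∫⁻ y in B, gaussKernel t (x - y)

theorem heatContent_eq_exchange (Ω : Set (E m)) (t : ℝ) :
    heatContent Ω t = exchange Ω Ω t := rfl

theorem continuous_gaussKernel (t : ℝ) : Continuous (gaussKernel (m := m) t) := by
  unfold gaussKernel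
  exact ENNReal.continuous_ofReal.comp (by fun_prop)

theorem measurable_gaussKernel (t : ℝ) : Measurable (gaussKernel (m := m) t) :=
  (continuous_gaussKernel t).measurable

theorem measurable_gaussKernel_sub (t : ℝ) :
    Measurable (fun p : E m × E m => gaussKernel t (p.1 - p.2)) :=
  ((continuous_gaussKernel t).comp (continuous_fst.sub continuous_snd)).measurable

theorem gaussKernel_neg (t : ℝ) (h : E m) : gaussKernel t (-h) = gaussKernel t h := by
  simp [gaussKernel]

theorem lintegral_gaussKernel {t : ℝ} (ht : 0 < t) : ∫⁻ h : E m, gaussKernel t h = 1 := by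
  have hb : (0 : ℝ) < 1 / (4 * t) := by positivity
  have h1 := GaussianFourier.integral_rexp_neg_mul_sq_norm (V := E m) hb
  have hint : Integrable (fun v : E m => Real.exp (-(1 / (4 * t)) * ‖v‖ ^ 2)) := by
    -- Integrability is read off from the value: the Bochner integral of a non-integrable function
    -- is `0`, while the Gaussian formula gives a positive number. The same device recurs below.
    by_contra hcon
    rw [integral_undef hcon] at h1
    have : (0 : ℝ) < (Real.pi / (1 / (4 * t))) ^ (Module.finrank ℝ (E m) / 2 : ℝ) := by
      positivity
    linarith
  have h2 : ∀ h : E m, gaussKernel t h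
      = ENNReal.ofReal ((4 * Real.pi * t) ^ (-(m : ℝ) / 2)
        * Real.exp (-(1 / (4 * t)) * ‖h‖ ^ 2)) := by
    intro h
    unfold gaussKernel
    congr 3
    field_simp
  simp_rw [h2]
  rw [← ofReal_integral_eq_lintegral_ofReal (hint.const_mul _)
    (Eventually.of_forall fun h => by positivity), integral_const_mul, h1]
  rw [finrank_euclideanSpace_fin, show Real.pi / (1 / (4 * t)) = 4 * Real.pi * t by field_simp,
    ← Real.rpow_add (by positivity), show -(m : ℝ) / 2 + m / 2 = 0 by ring]
  simp

theorem lintegral_gaussKernel_sub {t : ℝ} (ht : 0 < t) (x : E m) :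
    ∫⁻ y : E m, gaussKernel t (x - y) = 1 := by
  rw [lintegral_sub_left_eq_self (fun y => gaussKernel t y) x, lintegral_gaussKernel ht]

theorem measurable_lintegral_gaussKernel (B : Set (E m)) (t : ℝ) :
    Measurable (fun x : E m => ∫⁻ y in B, gaussKernel t (x - y)) :=
  Measurable.lintegral_prod_right' (f := fun p : E m × E m => gaussKernel t (p.1 - p.2))
    (measurable_gaussKernel_sub t)

theorem exchange_mono {A A' B B' : Set (E m)} (hA : A ⊆ A') (hB : B ⊆ B') (t : ℝ) :
    exchange A B t ≤ exchange A' B' t :=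
  (lintegral_mono fun _ => lintegral_mono_set hB).trans (lintegral_mono_set hA)

theorem exchange_add_compl {B : Set (E m)} (A : Set (E m)) (hB : MeasurableSet B) {t : ℝ}
    (ht : 0 < t) : exchange A B t + exchange A Bᶜ t = volume A := by
  unfold exchange
  rw [← lintegral_add_left (measurable_lintegral_gaussKernel B t)]
  simp_rw [lintegral_add_compl _ hB, lintegral_gaussKernel_sub ht]
  simp

theorem exchange_le_volume (A B : Set (E m)) {t : ℝ} (ht : 0 < t) :
    exchange A B t ≤ volume A := by
  calc exchange A B t ≤ exchange A Set.univ t :=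
        exchange_mono subset_rfl (Set.subset_univ B) t
    _ = volume A := by
        rw [exchange]
        simp [lintegral_gaussKernel_sub ht]

theorem exchange_swap (A B : Set (E m)) (t : ℝ) : exchange A B t = exchange B A t := by
  unfold exchange
  rw [lintegral_lintegral_swap (measurable_gaussKernel_sub t).aemeasurable]
  refine lintegral_congr fun y => lintegral_congr fun x => ?_
  rw [← gaussKernel_neg, neg_sub]

theorem exchange_le_mul (A B : Set (E m)) (t : ℝ) {c : ℝ≥0∞} (hA : MeasurableSet A)
    (hB : MeasurableSet B)
    (h : ∀ x ∈ A, ∀ y ∈ B, gaussKernel t (x - y) ≤ c) :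
    exchange A B t ≤ c * volume B * volume A := by
  unfold exchange
  calc ∫⁻ x in A, ∫⁻ y in B, gaussKernel t (x - y)
      ≤ ∫⁻ x in A, ∫⁻ y in B, c :=
        setLIntegral_mono' hA fun x hx => setLIntegral_mono' hB fun y hy => h x hx y hy
    _ = c * volume B * volume A := by simp

theorem gaussKernel_le (t : ℝ) (ht : 0 < t) (h : E m) :
    gaussKernel t h ≤ ENNReal.ofReal ((4 * Real.pi * t) ^ (-(m : ℝ) / 2)) := by
  unfold gaussKernel
  apply ENNReal.ofReal_le_ofReal
  apply mul_le_of_le_one_right (by positivity)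
  rw [Real.exp_le_one_iff]
  exact div_nonpos_of_nonpos_of_nonneg (by nlinarith [sq_nonneg ‖h‖]) (by positivity)

/-- Raise `v ≤ exp v`, with `v = u / (4 * q)`, to the power `q`. This trades Gaussian decay for any
power of `u = ‖h‖ ^ 2 / t`. -/
theorem rpow_mul_exp_le {q u : ℝ} (hq : 0 < q) (hu : 0 ≤ u) :
    u ^ q * Real.exp (-u / 4) ≤ (4 * q) ^ q := by
  have h1 : u / (4 * q) ≤ Real.exp (u / (4 * q)) :=
    (by linarith : u / (4 * q) ≤ u / (4 * q) + 1).trans (Real.add_one_le_exp _)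
  have h2 : (u / (4 * q)) ^ q ≤ Real.exp (u / 4) := by
    calc (u / (4 * q)) ^ q ≤ (Real.exp (u / (4 * q))) ^ q :=
          Real.rpow_le_rpow (by positivity) h1 hq.le
      _ = Real.exp (u / 4) := by
          rw [← Real.exp_mul]
          congr 1
          field_simp
  rw [Real.div_rpow hu (by positivity), div_le_iff₀ (by positivity)] at h2
  calc u ^ q * Real.exp (-u / 4) ≤ Real.exp (u / 4) * (4 * q) ^ q * Real.exp (-u / 4) := by
        gcongr
    _ = (4 * q) ^ q * (Real.exp (u / 4) * Real.exp (-u / 4)) := by ring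
    _ = (4 * q) ^ q := by
        rw [← Real.exp_add, show u / 4 + -u / 4 = 0 by ring]
        simp

/-- Off the origin the heat kernel is `O(t)`, with polynomial decay at infinity. -/
theorem exists_gaussKernel_le (m : ℕ) : ∃ C : ℝ, 0 < C ∧ ∀ t : ℝ, 0 < t → ∀ h : E m, h ≠ 0 →
    gaussKernel t h ≤ ENNReal.ofReal (C * t * ‖h‖ ^ (-((m : ℝ) + 2))) := by
  -- With this exponent `(‖h‖ ^ 2 / t) ^ (-q)` turns the prefactor `t ^ (-m / 2)` into a single
  -- power of `t` and leaves `‖h‖ ^ (-(m + 2))`, which is summable over an `m`-dimensional lattice.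
  set q : ℝ := (m : ℝ) / 2 + 1 with hq
  have hqpos : 0 < q := by positivity
  refine ⟨(4 * Real.pi) ^ (-(m : ℝ) / 2) * (4 * q) ^ q, by positivity, fun t ht h hh => ?_⟩
  have hn : 0 < ‖h‖ := norm_pos_iff.2 hh
  apply ENNReal.ofReal_le_ofReal
  have key := rpow_mul_exp_le hqpos (u := ‖h‖ ^ 2 / t) (by positivity)
  have e1 : (‖h‖ ^ 2 / t) ^ q = ‖h‖ ^ ((m : ℝ) + 2) * t ^ (-q) := by
    rw [Real.div_rpow (by positivity) ht.le, ← Real.rpow_natCast, ← Real.rpow_mul hn.le,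
      Real.rpow_neg ht.le, div_eq_mul_inv]
    congr 2
    rw [hq]; push_cast; ring
  have e2 : (4 * Real.pi * t) ^ (-(m : ℝ) / 2)
      = (4 * Real.pi) ^ (-(m : ℝ) / 2) * (t * t ^ (-q)) := by
    rw [Real.mul_rpow (by positivity) ht.le]
    congr 1
    nth_rewrite 2 [← Real.rpow_one t]
    rw [← Real.rpow_add ht]
    congr 1
    rw [hq]; ring
  have e3 : -‖h‖ ^ 2 / (4 * t) = -(‖h‖ ^ 2 / t) / 4 := by field_simp
  rw [e1] at key
  rw [e2, e3, Real.rpow_neg hn.le]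
  have hP : 0 < ‖h‖ ^ ((m : ℝ) + 2) := by positivity
  calc (4 * Real.pi) ^ (-(m : ℝ) / 2) * (t * t ^ (-q)) * Real.exp (-(‖h‖ ^ 2 / t) / 4)
      = (4 * Real.pi) ^ (-(m : ℝ) / 2) * t * (‖h‖ ^ ((m : ℝ) + 2))⁻¹ *
        (‖h‖ ^ ((m : ℝ) + 2) * t ^ (-q) * Real.exp (-(‖h‖ ^ 2 / t) / 4)) := by
        field_simp
    _ ≤ (4 * Real.pi) ^ (-(m : ℝ) / 2) * t * (‖h‖ ^ ((m : ℝ) + 2))⁻¹ * (4 * q) ^ q := by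
        gcongr
    _ = _ := by ring

/-- The second moment of the heat kernel is `O(t)`. -/
theorem exists_lintegral_gaussKernel_sq_le (m : ℕ) : ∃ C : ℝ, 0 < C ∧ ∀ t : ℝ, 0 < t →
    ∫⁻ h : E m, gaussKernel t h * ENNReal.ofReal (‖h‖ ^ 2) ≤ ENNReal.ofReal (C * t) := by
  refine ⟨8 * 2 ^ ((m : ℝ) / 2), by positivity, fun t ht => ?_⟩
  -- Half of the exponent is kept as the kernel at time `2 * t`, at the price `2 ^ (m / 2)`; the
  -- other half absorbs `‖h‖ ^ 2`, at the price `4 * (2 * t)`.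
  have key : ∀ h : E m, gaussKernel t h * ENNReal.ofReal (‖h‖ ^ 2)
      ≤ ENNReal.ofReal (8 * 2 ^ ((m : ℝ) / 2) * t) * gaussKernel (2 * t) h := by
    intro h
    unfold gaussKernel
    rw [← ENNReal.ofReal_mul (by positivity), ← ENNReal.ofReal_mul (by positivity)]
    apply ENNReal.ofReal_le_ofReal
    have h1 := rpow_mul_exp_le one_pos (u := ‖h‖ ^ 2 / (2 * t)) (by positivity)
    rw [Real.rpow_one, mul_one, Real.rpow_one] at h1
    have e1 : Real.exp (-‖h‖ ^ 2 / (4 * t)) = Real.exp (-‖h‖ ^ 2 / (4 * (2 * t))) *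
        Real.exp (-(‖h‖ ^ 2 / (2 * t)) / 4) := by
      rw [← Real.exp_add]
      congr 1
      field_simp
      ring
    have e2 : (4 * Real.pi * t) ^ (-(m : ℝ) / 2)
        = 2 ^ ((m : ℝ) / 2) * (4 * Real.pi * (2 * t)) ^ (-(m : ℝ) / 2) := by
      rw [show 4 * Real.pi * (2 * t) = 2 * (4 * Real.pi * t) by ring,
        Real.mul_rpow (x := 2) (by positivity) (by positivity), ← mul_assoc,
        ← Real.rpow_add (by positivity), show (m : ℝ) / 2 + -m / 2 = 0 by ring]
      simp
    rw [e1, e2]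
    have e3 : ‖h‖ ^ 2 = 2 * t * (‖h‖ ^ 2 / (2 * t)) := by field_simp
    set P := (4 * Real.pi * (2 * t)) ^ (-(m : ℝ) / 2)
    set Q := Real.exp (-‖h‖ ^ 2 / (4 * (2 * t)))
    have hP : 0 ≤ P := by positivity
    have hQ : 0 ≤ Q := by positivity
    calc 2 ^ ((m : ℝ) / 2) * P * (Q * Real.exp (-(‖h‖ ^ 2 / (2 * t)) / 4)) * ‖h‖ ^ 2
        = 2 ^ ((m : ℝ) / 2) * P * Q * (2 * t) * (‖h‖ ^ 2 / (2 * t) *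
            Real.exp (-(‖h‖ ^ 2 / (2 * t)) / 4)) := by
          nth_rewrite 2 [e3]
          ring
      _ ≤ 2 ^ ((m : ℝ) / 2) * P * Q * (2 * t) * 4 := by gcongr
      _ = _ := by ring
  calc ∫⁻ h : E m, gaussKernel t h * ENNReal.ofReal (‖h‖ ^ 2)
      ≤ ∫⁻ h : E m, ENNReal.ofReal (8 * 2 ^ ((m : ℝ) / 2) * t) * gaussKernel (2 * t) h :=
        lintegral_mono key
    _ = ENNReal.ofReal (8 * 2 ^ ((m : ℝ) / 2) * t) := by
        rw [lintegral_const_mul _ (measurable_gaussKernel _),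
          lintegral_gaussKernel (by positivity), mul_one]

/-! ### Volume of balls and the first moment of the kernel -/

/-- The volume of the unit ball of `ℝ^m`. -/
def unitBallVolume (m : ℕ) : ℝ := (volume (Metric.ball (0 : E m) 1)).toReal

theorem unitBallVolume_pos (m : ℕ) : 0 < unitBallVolume m :=
  ENNReal.toReal_pos (Metric.measure_ball_pos _ _ one_pos).ne' measure_ball_lt_top.ne

/-- Dimension zero has to be excluded: there the ball of radius `0` is empty while `r ^ m = 1`. -/
theorem volume_ball_eq (x : E m) {r : ℝ} (hr : 0 ≤ r) (hm : 0 < m) :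
    volume (Metric.ball x r) = ENNReal.ofReal (unitBallVolume m * r ^ m) := by
  have : Nonempty (Fin m) := ⟨⟨0, hm⟩⟩
  rw [Measure.addHaar_ball _ _ hr, finrank_euclideanSpace_fin, unitBallVolume, mul_comm,
    ENNReal.ofReal_mul ENNReal.toReal_nonneg, ENNReal.ofReal_toReal measure_ball_lt_top.ne]

theorem unitBallVolume_eq (m : ℕ) (hm : 0 < m) :
    unitBallVolume m = Real.sqrt Real.pi ^ m / Real.Gamma ((m : ℝ) / 2 + 1) := by
  have : Nonempty (Fin m) := ⟨⟨0, hm⟩⟩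
  have h := EuclideanSpace.volume_ball (Fin m) (0 : EuclideanSpace ℝ (Fin m)) 1
  have : 0 < Real.Gamma ((m : ℝ) / 2 + 1) := Real.Gamma_pos_of_pos (by positivity)
  rw [unitBallVolume, h]
  simp
  positivity

/-- The first moment of the heat kernel. -/
theorem lintegral_gaussKernel_norm {n : ℕ} (hn : 0 < n) {t : ℝ} (ht : 0 < t) :
    ∫⁻ h : E (n + 1), gaussKernel t h * ENNReal.ofReal (unitBallVolume n * ‖h‖)
      = ENNReal.ofReal (Real.pi ^ (-(1 / 2) : ℝ) *
        (((n : ℝ) + 1) * unitBallVolume (n + 1)) * t ^ (1 / 2 : ℝ)) := by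
  set A := (4 * Real.pi * t) ^ (-((n + 1 : ℕ) : ℝ) / 2) with hA
  set f : ℝ → ℝ := fun y => A * unitBallVolume n * (y * Real.exp (-(1 / (4 * t)) * y ^ (2 : ℝ)))
    with hf
  have hpt : ∀ h : E (n + 1), gaussKernel t h * ENNReal.ofReal (unitBallVolume n * ‖h‖)
      = ENNReal.ofReal (f ‖h‖) := by
    intro h
    unfold gaussKernel
    rw [← ENNReal.ofReal_mul (by positivity), ← hA, hf]
    congr 1
    simp only [Real.rpow_two]
    rw [show -‖h‖ ^ 2 / (4 * t) = -(1 / (4 * t)) * ‖h‖ ^ 2 by field_simp]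
    ring
  -- Polar coordinates reduce the first moment to a one-dimensional Gamma integral.
  have hval : ∫ y in Set.Ioi (0 : ℝ), y ^ ((n + 1 : ℕ) - 1) • f y
      = A * unitBallVolume n * ((1 / (4 * t)) ^ (-(((n + 1 : ℕ) : ℝ) + 1) / 2) * (1 / 2) *
        Real.Gamma ((((n + 1 : ℕ) : ℝ) + 1) / 2)) := by
    rw [← integral_rpow_mul_exp_neg_mul_rpow (by norm_num)
      (lt_of_lt_of_le (by norm_num) (Nat.cast_nonneg (n + 1))) (by positivity),
      ← integral_const_mul]
    refine setIntegral_congr_fun measurableSet_Ioi fun y hy => ?_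
    simp only [hf, smul_eq_mul, Nat.add_sub_cancel, Real.rpow_natCast]
    ring
  have hnn : ∀ h : E (n + 1), 0 ≤ f ‖h‖ := fun h => by
    have := (unitBallVolume_pos n).le
    simp only [hf]; positivity
  have htot := integral_fun_norm_addHaar (volume : Measure (E (n + 1))) f
  rw [finrank_euclideanSpace_fin, hval] at htot
  have hG : 0 < Real.Gamma ((((n + 1 : ℕ) : ℝ) + 1) / 2) := Real.Gamma_pos_of_pos (by positivity)
  have hω := unitBallVolume_pos n
  have hω' := unitBallVolume_pos (n + 1)
  have hreal : (volume : Measure (E (n + 1))).real (Metric.ball 0 1)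
    = unitBallVolume (n + 1) := rfl
  rw [hreal] at htot
  have hApos : 0 < A := by positivity
  have hint : Integrable (fun h : E (n + 1) => f ‖h‖) := by
    by_contra hcon
    rw [integral_undef hcon] at htot
    have : 0 < (n + 1) • unitBallVolume (n + 1) • (A * unitBallVolume n *
      ((1 / (4 * t)) ^ (-(((n + 1 : ℕ) : ℝ) + 1) / 2) * (1 / 2) *
        Real.Gamma ((((n + 1 : ℕ) : ℝ) + 1) / 2))) := by
      simp only [nsmul_eq_mul, smul_eq_mul]
      positivity
    linarith
  simp_rw [hpt]
  rw [← ofReal_integral_eq_lintegral_ofReal hint (Eventually.of_forall hnn), htot]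
  congr 1
  -- This Gamma value is the denominator of `unitBallVolume n`, so it cancels. What is left is the
  -- area of the unit sphere times `(t / π) ^ (1 / 2)`.
  have hGe : Real.Gamma ((((n + 1 : ℕ) : ℝ) + 1) / 2) = Real.Gamma ((n : ℝ) / 2 + 1) := by
    congr 1; push_cast; ring
  rw [hGe] at hG ⊢
  rw [unitBallVolume_eq n hn, hA]
  have e1 : (1 / (4 * t)) ^ (-(((n + 1 : ℕ) : ℝ) + 1) / 2) = (4 * t) ^ ((n : ℝ) / 2 + 1) := by
    rw [one_div, Real.inv_rpow (by positivity), ← Real.rpow_neg (by positivity)]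
    congr 1; push_cast; ring
  have e2 : (4 * Real.pi * t) ^ (-((n + 1 : ℕ) : ℝ) / 2)
      = Real.pi ^ (-(n : ℝ) / 2) * Real.pi ^ (-(1 / 2) : ℝ)
        * (4 * t) ^ (-((n : ℝ) / 2 + 1)) * (4 * t) ^ (1 / 2 : ℝ) := by
    rw [show 4 * Real.pi * t = Real.pi * (4 * t) by ring,
      Real.mul_rpow (by positivity) (by positivity), ← Real.rpow_add (by positivity), mul_assoc,
      ← Real.rpow_add (by positivity)]
    congr 2 <;> (push_cast; ring)
  have e3 : Real.sqrt Real.pi ^ n = Real.pi ^ ((n : ℝ) / 2) := by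
    rw [Real.sqrt_eq_rpow, ← Real.rpow_natCast, ← Real.rpow_mul (by positivity)]
    congr 1; ring
  have e4 : (4 * t) ^ (1 / 2 : ℝ) = 2 * t ^ (1 / 2 : ℝ) := by
    rw [Real.mul_rpow (by positivity) ht.le, ← Real.sqrt_eq_rpow,
      show (4 : ℝ) = 2 ^ 2 by norm_num, Real.sqrt_sq (by norm_num)]
  rw [e1, e2, e3, e4, Real.rpow_neg (x := 4 * t) (by positivity), show -(n : ℝ) / 2 = -((n : ℝ) / 2) by ring,
    Real.rpow_neg (x := Real.pi) (y := (n : ℝ) / 2) (by positivity)]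
  have hp1 : 0 < (4 * t) ^ ((n : ℝ) / 2 + 1) := by positivity
  have hp2 : 0 < Real.pi ^ ((n : ℝ) / 2) := by positivity
  simp only [nsmul_eq_mul, smul_eq_mul]
  generalize (4 * t) ^ ((n : ℝ) / 2 + 1) = P at *
  generalize Real.pi ^ ((n : ℝ) / 2) = Q at *
  push_cast
  field_simp

/-! ### Volume lost by a ball under translation -/

/-- The volume of the part of the centred ball of radius `r` that the translation by `h`
moves out of the ball. -/
def shiftLoss (r : ℝ) (h : E m) : ℝ≥0∞ :=
  volume {x : E m | ‖x‖ < r ∧ r ≤ ‖x + h‖}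

/-- Substitute `y = x + h` and apply Tonelli: for a fixed displacement `h` the kernel is constant,
and the points `x` of the ball with `x + h` outside are measured by `shiftLoss`. -/
theorem exchange_ball_compl_eq (r t : ℝ) :
    exchange (Metric.ball (0 : E m) r) (Metric.ball 0 r)ᶜ t
      = ∫⁻ h : E m, gaussKernel t h * shiftLoss r h := by
  have hB : MeasurableSet (Metric.ball (0 : E m) r) := measurableSet_ball
  have hS : MeasurableSet {p : E m × E m | ‖p.1‖ < r ∧ r ≤ ‖p.1 + p.2‖} := by
    rw [Set.ofPred_and]
    exact (measurableSet_lt (by fun_prop) (by fun_prop)).inter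
      (measurableSet_le (by fun_prop) (by fun_prop))
  classical
  let F : E m → E m → ℝ≥0∞ := fun x h => if ‖x‖ < r ∧ r ≤ ‖x + h‖ then gaussKernel t h else 0
  have hF1 : ∀ x h, ‖x‖ < r ∧ r ≤ ‖x + h‖ → F x h = gaussKernel t h := fun x h hxh => if_pos hxh
  have hF0 : ∀ x h, ¬ (‖x‖ < r ∧ r ≤ ‖x + h‖) → F x h = 0 := fun x h hxh => if_neg hxh
  have hmeas : Measurable (Function.uncurry F) :=
    Measurable.ite hS ((measurable_gaussKernel t).comp measurable_snd) measurable_const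
  have h1 : exchange (Metric.ball (0 : E m) r) (Metric.ball 0 r)ᶜ t
      = ∫⁻ x : E m, ∫⁻ h : E m, F x h := by
    unfold exchange
    rw [← lintegral_indicator hB]
    refine lintegral_congr fun x => ?_
    by_cases hx : x ∈ Metric.ball (0 : E m) r
    · rw [Set.indicator_of_mem hx, ← lintegral_indicator hB.compl,
        ← lintegral_add_left_eq_self _ x]
      refine lintegral_congr fun h => ?_
      rw [mem_ball_zero_iff] at hx
      by_cases hh : r ≤ ‖x + h‖
      · rw [hF1 x h ⟨hx, hh⟩, Set.indicator_of_mem (by simpa using hh), ← gaussKernel_neg]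
        congr 1
        abel
      · rw [hF0 x h (fun h' => hh h'.2), Set.indicator_of_notMem (by simpa using hh)]
    · rw [Set.indicator_of_notMem hx]
      rw [mem_ball_zero_iff] at hx
      simp [hF0 x _ (fun h' => hx h'.1)]
  rw [h1, lintegral_lintegral_swap hmeas.aemeasurable]
  refine lintegral_congr fun h => ?_
  have hSh : MeasurableSet {x : E m | ‖x‖ < r ∧ r ≤ ‖x + h‖} := by
    rw [Set.ofPred_and]
    exact (measurableSet_lt (by fun_prop) (by fun_prop)).inter
      (measurableSet_le (by fun_prop) (by fun_prop))
  rw [shiftLoss, ← lintegral_indicator_const hSh]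
  refine lintegral_congr fun x => ?_
  by_cases hx : ‖x‖ < r ∧ r ≤ ‖x + h‖
  · rw [hF1 x h hx, Set.indicator_of_mem (Set.mem_ofPred_eq ▸ hx)]
  · rw [hF0 x h hx, Set.indicator_of_notMem (Set.mem_ofPred_eq ▸ hx)]

theorem shiftLoss_map (e : E m ≃ₗᵢ[ℝ] E m) (r : ℝ) (h : E m) :
    shiftLoss r (e h) = shiftLoss r h := by
  unfold shiftLoss
  have hS : MeasurableSet {x : E m | ‖x‖ < r ∧ r ≤ ‖x + e h‖} := by
    rw [Set.ofPred_and]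
    exact (measurableSet_lt (by fun_prop) (by fun_prop)).inter
      (measurableSet_le (by fun_prop) (by fun_prop))
  rw [← e.measurePreserving.measure_preimage hS.nullMeasurableSet]
  congr 1
  ext x
  simp [← map_add]

/-- The reflection in the hyperplane orthogonal to `v - w` does this. With `shiftLoss_map` it allows
any translation to be aligned with the first coordinate axis. -/
theorem exists_isometry_map_eq (v w : E m) (hvw : ‖v‖ = ‖w‖) : ∃ e : E m ≃ₗᵢ[ℝ] E m, e v = w :=
  ⟨_, Submodule.reflection_sub hvw⟩

/-- The points form the interval of half-length `√s`, which loses `min h (2 * √s)` when moved by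
`h`. The form with squares also covers `s ≤ 0`, where the interval is empty and `Real.sqrt s = 0`.
-/
theorem volume_interval_shift (s h : ℝ) (hh : 0 ≤ h) :
    volume {x : ℝ | x ^ 2 < s ∧ s ≤ (x + h) ^ 2}
      = ENNReal.ofReal (min h (2 * Real.sqrt s)) := by
  rcases le_or_gt s 0 with hs | hs
  · have : {x : ℝ | x ^ 2 < s ∧ s ≤ (x + h) ^ 2} = ∅ := by
      ext x
      simp only [Set.mem_ofPred_eq, Set.mem_empty_iff_false, iff_false, not_and]
      intro hx
      nlinarith [sq_nonneg x]
    rw [this, Real.sqrt_eq_zero_of_nonpos hs]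
    simp [hh]
  · set L := Real.sqrt s with hL
    have hLpos : 0 < L := Real.sqrt_pos.2 hs
    have hsL : s = L ^ 2 := (Real.sq_sqrt hs.le).symm
    have hset : {x : ℝ | x ^ 2 < s ∧ s ≤ (x + h) ^ 2} = Set.Ioo (-L) L ∩ Set.Ici (L - h) := by
      ext x
      simp only [Set.mem_ofPred_eq, Set.mem_inter_iff, Set.mem_Ioo, Set.mem_Ici, hsL]
      rw [sq_lt_sq, abs_of_pos hLpos, abs_lt]
      refine and_congr_right fun hx => ?_
      constructor
      · intro h1
        by_contra hcon
        exact absurd (sq_lt_sq' (by linarith [hx.1]) (by linarith : x + h < L)) h1.not_gt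
      · intro h1
        exact pow_le_pow_left₀ hLpos.le (by linarith) 2
    rw [hset]
    rcases lt_or_ge h (2 * L) with h2 | h2
    · have : Set.Ioo (-L) L ∩ Set.Ici (L - h) = Set.Ico (L - h) L := by
        ext x
        simp only [Set.mem_inter_iff, Set.mem_Ioo, Set.mem_Ici, Set.mem_Ico]
        exact ⟨fun hx => ⟨hx.2, hx.1.2⟩, fun hx => ⟨⟨by linarith [hx.1], hx.2⟩, hx.1⟩⟩
      rw [this, Real.volume_Ico, min_eq_left h2.le]
      congr 1; ring
    · have : Set.Ioo (-L) L ∩ Set.Ici (L - h) = Set.Ioo (-L) L := by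
        apply Set.inter_eq_left.2
        intro x hx
        simp only [Set.mem_Ioo, Set.mem_Ici] at hx ⊢
        linarith
      rw [this, Real.volume_Ioo, min_eq_right h2]
      congr 1; ring

/-- Splitting off the first coordinate. -/
def splitFirst {n : ℕ} (x : E (n + 1)) : ℝ × E n :=
  (x 0, WithLp.toLp 2 fun i : Fin n => x i.succ)

theorem measurePreserving_splitFirst (n : ℕ) :
    MeasurePreserving (splitFirst (n := n)) volume volume := by
  have h1 := PiLp.volume_preserving_ofLp (Fin (n + 1))
  have h2 := volume_preserving_piFinSuccAbove (fun _ : Fin (n + 1) => ℝ) 0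
  have h3 := (MeasurePreserving.id (volume : Measure ℝ)).prod (PiLp.volume_preserving_toLp (Fin n))
  exact (h3.comp (h2.comp h1))

theorem norm_sq_splitFirst {n : ℕ} (x : E (n + 1)) :
    ‖x‖ ^ 2 = (splitFirst x).1 ^ 2 + ‖(splitFirst x).2‖ ^ 2 := by
  rw [EuclideanSpace.real_norm_sq_eq, EuclideanSpace.real_norm_sq_eq, Fin.sum_univ_succ]
  rfl

/-- Fubini over the lines parallel to the axis: the line over `y` meets the ball in a chord of
length `2 * √(r ^ 2 - ‖y‖ ^ 2)`. Lines missing the ball contribute `0`, since the square root of a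
negative number is `0`, so no domain restriction is needed. -/
theorem shiftLoss_single {n : ℕ} {r : ℝ} (hr : 0 ≤ r) {h : ℝ} (hh : 0 ≤ h) :
    shiftLoss r (EuclideanSpace.single (0 : Fin (n + 1)) h)
      = ∫⁻ y : E n, ENNReal.ofReal (min h (2 * Real.sqrt (r ^ 2 - ‖y‖ ^ 2))) := by
  set S : Set (ℝ × E n) := {p | p.1 ^ 2 < r ^ 2 - ‖p.2‖ ^ 2 ∧ r ^ 2 - ‖p.2‖ ^ 2 ≤ (p.1 + h) ^ 2}
    with hSdef
  have hS : MeasurableSet S := by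
    rw [hSdef, Set.ofPred_and]
    exact (measurableSet_lt (by fun_prop) (by fun_prop)).inter
      (measurableSet_le (by fun_prop) (by fun_prop))
  have hpre : {x : E (n + 1) | ‖x‖ < r ∧ r ≤ ‖x + EuclideanSpace.single (0 : Fin (n + 1)) h‖}
      = splitFirst ⁻¹' S := by
    ext x
    have e1 := norm_sq_splitFirst x
    have e2 := norm_sq_splitFirst (x + EuclideanSpace.single (0 : Fin (n + 1)) h)
    have e3 : (splitFirst (x + EuclideanSpace.single (0 : Fin (n + 1)) h)).1
        = (splitFirst x).1 + h := by simp [splitFirst]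
    have e4 : (splitFirst (x + EuclideanSpace.single (0 : Fin (n + 1)) h)).2
        = (splitFirst x).2 := by
      ext i
      simp [splitFirst]
    rw [e3, e4] at e2
    simp only [Set.mem_ofPred_eq, Set.mem_preimage, hSdef]
    rw [← pow_lt_pow_iff_left₀ (norm_nonneg x) hr two_ne_zero,
      ← pow_le_pow_iff_left₀ hr (norm_nonneg _) two_ne_zero, e1, e2]
    constructor <;> rintro ⟨h1, h2⟩ <;> constructor <;> linarith
  rw [shiftLoss, hpre, (measurePreserving_splitFirst n).measure_preimage hS.nullMeasurableSet,
    Measure.volume_eq_prod, Measure.prod_apply_symm hS]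
  refine lintegral_congr fun y => ?_
  rw [← volume_interval_shift _ _ hh]
  rfl

/-- The volume lost under a translation, as an integral over the chords in its direction. -/
theorem shiftLoss_eq {n : ℕ} {r : ℝ} (hr : 0 ≤ r) (h : E (n + 1)) :
    shiftLoss r h
      = ∫⁻ y : E n, ENNReal.ofReal (min ‖h‖ (2 * Real.sqrt (r ^ 2 - ‖y‖ ^ 2))) := by
  obtain ⟨e, he⟩ := exists_isometry_map_eq h (EuclideanSpace.single (0 : Fin (n + 1)) ‖h‖)
    (by simp)
  rw [← shiftLoss_map e, he, shiftLoss_single hr (norm_nonneg h)]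

/-- The regions whose volumes are compared are not nested; the monotonicity is visible only in the
chord formula. -/
theorem shiftLoss_mono {n : ℕ} {r R : ℝ} (hr : 0 ≤ r) (hrR : r ≤ R) (h : E (n + 1)) :
    shiftLoss r h ≤ shiftLoss R h := by
  rw [shiftLoss_eq hr, shiftLoss_eq (hr.trans hrR)]
  gcongr

theorem shiftLoss_le {n : ℕ} (hn : 0 < n) {r : ℝ} (hr : 0 ≤ r) (h : E (n + 1)) :
    shiftLoss r h ≤ ENNReal.ofReal (r ^ n) * ENNReal.ofReal (unitBallVolume n * ‖h‖) := by
  rw [shiftLoss_eq hr]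
  calc ∫⁻ y : E n, ENNReal.ofReal (min ‖h‖ (2 * Real.sqrt (r ^ 2 - ‖y‖ ^ 2)))
      ≤ ∫⁻ y : E n, (Metric.ball (0 : E n) r).indicator (fun _ => ENNReal.ofReal ‖h‖) y := by
        refine lintegral_mono fun y => ?_
        by_cases hy : y ∈ Metric.ball (0 : E n) r
        · rw [Set.indicator_of_mem hy]
          exact ENNReal.ofReal_le_ofReal (min_le_left _ _)
        · rw [Set.indicator_of_notMem hy]
          rw [mem_ball_zero_iff, not_lt] at hy
          rw [Real.sqrt_eq_zero_of_nonpos (by nlinarith)]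
          simp
    _ = _ := by
        rw [lintegral_indicator_const measurableSet_ball, volume_ball_eq _ hr hn,
          ← ENNReal.ofReal_mul (by positivity), ← ENNReal.ofReal_mul (by positivity)]
        congr 1; ring

theorem pow_sub_pow_le_mul {r s : ℝ} (hs : 0 ≤ s) (hsr : s ≤ r) (n : ℕ) :
    r ^ (n + 1) - s ^ (n + 1) ≤ (n + 1) * r ^ n * (r - s) := by
  induction n with
  | zero => simp
  | succ k ih =>
    have h1 : s ^ (k + 1) ≤ r ^ (k + 1) := pow_le_pow_left₀ hs hsr _
    have h2 : r ^ (k + 1 + 1) - s ^ (k + 1 + 1)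
        = r * (r ^ (k + 1) - s ^ (k + 1)) + (r - s) * s ^ (k + 1) := by ring
    have h3 : r * (r ^ (k + 1) - s ^ (k + 1)) ≤ r * ((k + 1) * r ^ k * (r - s)) :=
      mul_le_mul_of_nonneg_left ih (hs.trans hsr)
    have h4 : (r - s) * s ^ (k + 1) ≤ (r - s) * r ^ (k + 1) :=
      mul_le_mul_of_nonneg_left h1 (by linarith)
    rw [h2]
    push_cast
    calc _ ≤ r * ((k + 1) * r ^ k * (r - s)) + (r - s) * r ^ (k + 1) := by linarith
      _ = _ := by ring

/-- A bound for the volume of the set of short chords. -/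
theorem volume_short_chords_le {k : ℕ} {r : ℝ} (hr : 0 ≤ r) {d : ℝ} (hd : 0 ≤ d) :
    volume {y : E (k + 1) | ‖y‖ < r ∧ 2 * Real.sqrt (r ^ 2 - ‖y‖ ^ 2) < d}
      ≤ ENNReal.ofReal (unitBallVolume (k + 1) * (k + 1) * min (r ^ (k + 1)) (r ^ k * d)) := by
  set A := {y : E (k + 1) | ‖y‖ < r ∧ 2 * Real.sqrt (r ^ 2 - ‖y‖ ^ 2) < d}
  have hω := (unitBallVolume_pos (k + 1)).le
  have hAr : A ⊆ Metric.ball 0 r := fun y hy => mem_ball_zero_iff.2 hy.1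
  have h1 : volume A ≤ ENNReal.ofReal (unitBallVolume (k + 1) * r ^ (k + 1)) := by
    rw [← volume_ball_eq 0 hr (Nat.add_one_pos k)]
    exact measure_mono hAr
  rw [mul_min_of_nonneg _ _ (by positivity), ENNReal.ofReal_min]
  refine le_min (h1.trans ?_) ?_
  · apply ENNReal.ofReal_le_ofReal
    have : (0 : ℝ) ≤ k * (unitBallVolume (k + 1) * r ^ (k + 1)) := by positivity
    nlinarith
  · rcases lt_or_ge r (d / 2) with h2 | h2
    · refine h1.trans (ENNReal.ofReal_le_ofReal ?_)
      have h3 : unitBallVolume (k + 1) * r ^ (k + 1) ≤ unitBallVolume (k + 1) * (r ^ k * d) := by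
        rw [pow_succ]
        gcongr
        linarith
      have : (0 : ℝ) ≤ k * (unitBallVolume (k + 1) * (r ^ k * d)) := by positivity
      nlinarith
    · have hsub : A ⊆ Metric.ball 0 r \ Metric.ball 0 (r - d / 2) := by
        intro y hy
        refine ⟨hAr hy, ?_⟩
        rw [mem_ball_zero_iff, not_lt]
        obtain ⟨hy1, hy2⟩ := hy
        -- A chord at distance `‖y‖` from the centre has half-length at least `r - ‖y‖`, so short
        -- chords lie in the annulus of width `d / 2` at the rim.
        have h3 : r - ‖y‖ ≤ Real.sqrt (r ^ 2 - ‖y‖ ^ 2) := by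
          apply Real.le_sqrt_of_sq_le
          nlinarith [norm_nonneg y]
        linarith
      refine (measure_mono hsub).trans ?_
      rw [measure_sdiff (Metric.ball_subset_ball (by linarith))
        measurableSet_ball.nullMeasurableSet measure_ball_lt_top.ne,
        volume_ball_eq _ hr (Nat.add_one_pos k), volume_ball_eq _ (by linarith) (Nat.add_one_pos k),
        ← ENNReal.ofReal_sub _ (by have : 0 ≤ r - d / 2 := by linarith
                                   positivity)]
      apply ENNReal.ofReal_le_ofReal
      have h3 := pow_sub_pow_le_mul (r := r) (s := r - d / 2) (by linarith) (by linarith) k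
      rw [← mul_sub, mul_assoc]
      apply mul_le_mul_of_nonneg_left _ hω
      refine h3.trans ?_
      have h4 : (0 : ℝ) ≤ (k + 1) * r ^ k * d := by positivity
      nlinarith

/-- Chords of length at least `‖h‖` lose exactly `‖h‖`; the defect comes only from shorter chords,
each missing at most `‖h‖`, over a base controlled by `volume_short_chords_le`. The first entry of
the minimum is the useful one when `r` is smaller than `‖h‖`, the second when it is larger. -/
theorem le_shiftLoss_add {k : ℕ} {r : ℝ} (hr : 0 ≤ r) (h : E (k + 1 + 1)) :
    ENNReal.ofReal (r ^ (k + 1)) * ENNReal.ofReal (unitBallVolume (k + 1) * ‖h‖)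
      ≤ shiftLoss r h + ENNReal.ofReal (unitBallVolume (k + 1) * (k + 1) *
        min (r ^ (k + 1) * ‖h‖) (r ^ k * ‖h‖ ^ 2)) := by
  have hω := (unitBallVolume_pos (k + 1)).le
  set A := {y : E (k + 1) | ‖y‖ < r ∧ 2 * Real.sqrt (r ^ 2 - ‖y‖ ^ 2) < ‖h‖} with hAdef
  have hA : MeasurableSet A := by
    rw [hAdef, Set.ofPred_and]
    exact (measurableSet_lt (by fun_prop) (by fun_prop)).inter
      (measurableSet_lt (by fun_prop) (by fun_prop))
  calc ENNReal.ofReal (r ^ (k + 1)) * ENNReal.ofReal (unitBallVolume (k + 1) * ‖h‖)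
      = ∫⁻ y : E (k + 1), (Metric.ball 0 r).indicator (fun _ => ENNReal.ofReal ‖h‖) y := by
        rw [lintegral_indicator_const measurableSet_ball, volume_ball_eq _ hr (Nat.add_one_pos k),
          ← ENNReal.ofReal_mul (by positivity), ← ENNReal.ofReal_mul (by positivity)]
        congr 1; ring
    _ ≤ ∫⁻ y : E (k + 1), (ENNReal.ofReal (min ‖h‖ (2 * Real.sqrt (r ^ 2 - ‖y‖ ^ 2)))
          + A.indicator (fun _ => ENNReal.ofReal ‖h‖) y) := by
        refine lintegral_mono fun y => ?_
        by_cases hy : y ∈ Metric.ball (0 : E (k + 1)) r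
        · rw [Set.indicator_of_mem hy]
          by_cases hyA : y ∈ A
          · rw [Set.indicator_of_mem hyA]
            exact le_add_self
          · rw [min_eq_left, Set.indicator_of_notMem hyA, add_zero]
            by_contra hcon
            exact hyA ⟨mem_ball_zero_iff.1 hy, not_le.1 hcon⟩
        · simp [Set.indicator_of_notMem hy]
    _ = shiftLoss r h + ENNReal.ofReal ‖h‖ * volume A := by
        rw [lintegral_add_right _ (measurable_const.indicator hA), ← shiftLoss_eq hr,
          lintegral_indicator_const hA]
    _ ≤ _ := by
        gcongr
        refine (mul_le_mul_right (volume_short_chords_le hr (norm_nonneg h)) _).trans ?_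
        rw [← ENNReal.ofReal_mul (norm_nonneg h)]
        apply ENNReal.ofReal_le_ofReal
        rw [mul_left_comm, mul_min_of_nonneg _ _ (norm_nonneg h)]
        apply le_of_eq
        congr 2 <;> ring

/-! ### Heat loss of a single ball -/

/-- The heat loss of a ball. -/
def ballLoss (m : ℕ) (r t : ℝ) : ℝ≥0∞ :=
  exchange (Metric.ball (0 : E m) r) (Metric.ball 0 r)ᶜ t

/-- The perimeter of the unit ball of `ℝ^m`. -/
def unitSphereArea (m : ℕ) : ℝ := m * unitBallVolume m

theorem ballLoss_mono {n : ℕ} {r R : ℝ} (hr : 0 ≤ r) (hrR : r ≤ R) (t : ℝ) :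
    ballLoss (n + 1) r t ≤ ballLoss (n + 1) R t := by
  unfold ballLoss
  rw [exchange_ball_compl_eq, exchange_ball_compl_eq]
  refine lintegral_mono fun h => ?_
  gcongr
  exact shiftLoss_mono hr hrR h

theorem lintegral_gaussKernel_surface {n : ℕ} (hn : 0 < n) {r t : ℝ} (hr : 0 ≤ r) (ht : 0 < t) :
    ∫⁻ h : E (n + 1), gaussKernel t h *
        (ENNReal.ofReal (r ^ n) * ENNReal.ofReal (unitBallVolume n * ‖h‖))
      = ENNReal.ofReal (Real.pi ^ (-(1 / 2) : ℝ) * unitSphereArea (n + 1) * r ^ n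
          * t ^ (1 / 2 : ℝ)) := by
  simp_rw [mul_left_comm _ (ENNReal.ofReal (r ^ n))]
  rw [lintegral_const_mul' _ _ ENNReal.ofReal_ne_top, lintegral_gaussKernel_norm hn ht,
    ← ENNReal.ofReal_mul (by positivity), unitSphereArea]
  congr 1
  push_cast
  ring

theorem ballLoss_le {n : ℕ} (hn : 0 < n) {r t : ℝ} (hr : 0 ≤ r) (ht : 0 < t) :
    ballLoss (n + 1) r t ≤ ENNReal.ofReal (Real.pi ^ (-(1 / 2) : ℝ) * unitSphereArea (n + 1)
      * r ^ n * t ^ (1 / 2 : ℝ)) := by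
  unfold ballLoss
  rw [exchange_ball_compl_eq, ← lintegral_gaussKernel_surface hn hr ht]
  refine lintegral_mono fun h => ?_
  gcongr
  exact shiftLoss_le hn hr h

/-- Integrate the chord defect against the kernel. The two entries of the minimum use the first and
the second moment of the kernel respectively, of orders `t ^ (1 / 2)` and `t`. -/
theorem exists_le_ballLoss_add (k : ℕ) : ∃ C : ℝ, 0 < C ∧ ∀ r t : ℝ, 0 ≤ r → 0 < t →
    ENNReal.ofReal (Real.pi ^ (-(1 / 2) : ℝ) * unitSphereArea (k + 2)
      * r ^ (k + 1) * t ^ (1 / 2 : ℝ)) ≤ ballLoss (k + 2) r t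
        + ENNReal.ofReal (C * min (r ^ (k + 1) * t ^ (1 / 2 : ℝ)) (r ^ k * t)) := by
  obtain ⟨C₂, hC₂, hsq⟩ := exists_lintegral_gaussKernel_sq_le (k + 2)
  have hω := unitBallVolume_pos (k + 1)
  have hσ : 0 < Real.pi ^ (-(1 / 2) : ℝ) * unitSphereArea (k + 2) := by
    have := unitBallVolume_pos (k + 2)
    unfold unitSphereArea
    positivity
  set C₁ := ((k : ℝ) + 1) * (Real.pi ^ (-(1 / 2) : ℝ) * unitSphereArea (k + 2)) with hC₁
  set C₃ := unitBallVolume (k + 1) * (k + 1) * C₂ with hC₃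
  refine ⟨max C₁ C₃, lt_max_of_lt_right (by positivity), fun r t hr ht => ?_⟩
  rw [← lintegral_gaussKernel_surface (Nat.add_one_pos k) hr ht, ballLoss, exchange_ball_compl_eq]
  set D : E (k + 2) → ℝ≥0∞ := fun h => ENNReal.ofReal (unitBallVolume (k + 1) * (k + 1) *
        min (r ^ (k + 1) * ‖h‖) (r ^ k * ‖h‖ ^ 2)) with hD
  have hDm : Measurable fun h : E (k + 2) => gaussKernel t h * D h :=
    (measurable_gaussKernel t).mul (ENNReal.measurable_ofReal.comp (by fun_prop))
  have hbound : ∫⁻ h : E (k + 2), gaussKernel t h * D h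
      ≤ ENNReal.ofReal (max C₁ C₃ * min (r ^ (k + 1) * t ^ (1 / 2 : ℝ)) (r ^ k * t)) := by
    rw [mul_min_of_nonneg _ _ (le_max_of_le_right (by positivity)), ENNReal.ofReal_min]
    refine le_min ?_ ?_
    · calc ∫⁻ h : E (k + 2), gaussKernel t h * D h
          ≤ ∫⁻ h : E (k + 2), ENNReal.ofReal ((k : ℝ) + 1) * (gaussKernel t h *
            (ENNReal.ofReal (r ^ (k + 1)) * ENNReal.ofReal (unitBallVolume (k + 1) * ‖h‖))) := by
            refine lintegral_mono fun h => ?_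
            rw [mul_left_comm]
            gcongr
            rw [← ENNReal.ofReal_mul (by positivity), ← ENNReal.ofReal_mul (by positivity)]
            apply ENNReal.ofReal_le_ofReal
            calc _ ≤ unitBallVolume (k + 1) * (k + 1) * (r ^ (k + 1) * ‖h‖) := by
                  gcongr
                  exact min_le_left _ _
              _ = _ := by ring
        _ = ENNReal.ofReal (C₁ * (r ^ (k + 1) * t ^ (1 / 2 : ℝ))) := by
            rw [lintegral_const_mul' _ _ ENNReal.ofReal_ne_top,
              lintegral_gaussKernel_surface (Nat.add_one_pos k) hr ht, ← ENNReal.ofReal_mul (by positivity)]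
            congr 1
            rw [hC₁]; ring
        _ ≤ _ := by
            apply ENNReal.ofReal_le_ofReal
            gcongr
            exact le_max_left _ _
    · calc ∫⁻ h : E (k + 2), gaussKernel t h * D h
          ≤ ∫⁻ h : E (k + 2), ENNReal.ofReal (unitBallVolume (k + 1) * (k + 1) * r ^ k) *
            (gaussKernel t h * ENNReal.ofReal (‖h‖ ^ 2)) := by
            refine lintegral_mono fun h => ?_
            rw [mul_left_comm]
            gcongr
            rw [← ENNReal.ofReal_mul (by positivity)]
            apply ENNReal.ofReal_le_ofReal
            rw [mul_assoc _ (r ^ k)]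
            gcongr
            exact min_le_right _ _
        _ ≤ ENNReal.ofReal (unitBallVolume (k + 1) * (k + 1) * r ^ k) *
              ENNReal.ofReal (C₂ * t) := by
            rw [lintegral_const_mul' _ _ ENNReal.ofReal_ne_top]
            gcongr
            exact hsq t ht
        _ = ENNReal.ofReal (C₃ * (r ^ k * t)) := by
            rw [← ENNReal.ofReal_mul (by positivity)]
            congr 1
            rw [hC₃]; ring
        _ ≤ _ := by
            apply ENNReal.ofReal_le_ofReal
            gcongr
            exact le_max_right _ _
  refine le_trans ?_ (add_le_add_right hbound _)
  rw [← lintegral_add_right _ hDm]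
  refine lintegral_mono fun h => ?_
  rw [← mul_add]
  gcongr
  exact le_shiftLoss_add hr h

/-! ### Comparison of sums and integrals -/

theorem tsum_pnat_eq_tsum_nat (f : ℝ → ℝ≥0∞) :
    ∑' i : ℕ+, f ((i : ℕ) : ℝ) = ∑' n : ℕ, f ((n : ℝ) + 1) := by
  rw [← Equiv.pnatEquivNat.symm.tsum_eq]
  refine tsum_congr fun n => ?_
  simp [Equiv.pnatEquivNat]

theorem lintegral_Ioi_one_eq_tsum (f : ℝ → ℝ≥0∞) :
    ∫⁻ x in Set.Ioi 1, f x = ∑' n : ℕ, ∫⁻ x in Set.Ioc ((n : ℝ) + 1) ((n : ℝ) + 2), f x := by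
  have hU : Set.Ioi (1 : ℝ) = ⋃ n : ℕ, Set.Ioc ((n : ℝ) + 1) ((n : ℝ) + 2) := by
    ext x
    simp only [Set.mem_Ioi, Set.mem_iUnion, Set.mem_Ioc]
    constructor
    · intro hx
      obtain ⟨n, hn⟩ : ∃ n : ℕ, ⌈x⌉₊ = n + 2 := by
        have : 1 < ⌈x⌉₊ := Nat.lt_ceil.2 (by simpa using hx)
        exact ⟨⌈x⌉₊ - 2, by omega⟩
      refine ⟨n, ?_, ?_⟩
      · have : ((n + 1 : ℕ) : ℝ) < x := Nat.lt_ceil.1 (by omega)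
        push_cast at this
        exact this
      · have : x ≤ ((n + 2 : ℕ) : ℝ) := Nat.ceil_le.1 hn.le
        push_cast at this
        exact this
    · rintro ⟨n, h1, -⟩
      have : (0 : ℝ) ≤ n := Nat.cast_nonneg n
      linarith
  rw [hU]
  refine lintegral_iUnion (fun n => measurableSet_Ioc) ?_ f
  have hmono : Monotone fun n : ℕ => (n : ℝ) + 1 := fun a b h => by
    have : (a : ℝ) ≤ b := by exact_mod_cast h
    simpa using this
  have h := hmono.pairwise_disjoint_on_Ioc_succ
  intro i j hij
  have h' := h hij
  simp only [Function.onFun, Nat.succ_eq_succ, Nat.succ_eq_add_one, Nat.cast_add,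
    Nat.cast_one] at h'
  have e : ∀ k : ℕ, (k : ℝ) + 1 + 1 = k + 2 := fun k => by ring
  simpa only [Function.onFun, e] using h'

/-- Monotonicity is asked only on `(0, ∞)`, because the functions of interest may be unbounded at
`0`. -/
theorem lintegral_le_tsum {f : ℝ → ℝ≥0∞} (hf : AntitoneOn f (Set.Ioi 0)) :
    ∫⁻ x in Set.Ioi 1, f x ≤ ∑' i : ℕ+, f ((i : ℕ) : ℝ) := by
  rw [tsum_pnat_eq_tsum_nat, lintegral_Ioi_one_eq_tsum]
  refine ENNReal.tsum_le_tsum fun n => ?_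
  have hn : (0 : ℝ) ≤ n := Nat.cast_nonneg n
  calc ∫⁻ x in Set.Ioc ((n : ℝ) + 1) ((n : ℝ) + 2), f x
      ≤ ∫⁻ x in Set.Ioc ((n : ℝ) + 1) ((n : ℝ) + 2), f ((n : ℝ) + 1) :=
        setLIntegral_mono' measurableSet_Ioc fun x hx =>
          hf (Set.mem_Ioi.2 (by linarith)) (Set.mem_Ioi.2 (by linarith [hx.1])) hx.1.le
    _ = f ((n : ℝ) + 1) := by
        rw [setLIntegral_const, Real.volume_Ioc]
        ring_nf
        simp

theorem tsum_le_lintegral {f : ℝ → ℝ≥0∞} (hf : AntitoneOn f (Set.Ioi 0)) :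
    ∑' i : ℕ+, f ((i : ℕ) : ℝ) ≤ f 1 + ∫⁻ x in Set.Ioi 1, f x := by
  rw [tsum_pnat_eq_tsum_nat, lintegral_Ioi_one_eq_tsum, tsum_eq_zero_add' ENNReal.summable]
  simp only [Nat.cast_zero, zero_add]
  gcongr with n
  have hn : (0 : ℝ) ≤ n := Nat.cast_nonneg n
  push_cast
  rw [show (n : ℝ) + 1 + 1 = n + 2 by ring]
  calc f ((n : ℝ) + 2) = ∫⁻ x in Set.Ioc ((n : ℝ) + 1) ((n : ℝ) + 2), f ((n : ℝ) + 2) := by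
        rw [setLIntegral_const, Real.volume_Ioc]
        ring_nf
        simp
    _ ≤ _ := setLIntegral_mono' measurableSet_Ioc fun x hx =>
          hf (Set.mem_Ioi.2 (by linarith [hx.1])) (Set.mem_Ioi.2 (by linarith)) hx.2

/-! ### Scaling and exact integration over the family of radii -/

theorem lintegral_comp_smul_eq (f : E m → ℝ≥0∞) {ρ : ℝ} (hρ : 0 < ρ) :
    ∫⁻ x : E m, f x = ENNReal.ofReal (ρ ^ m) * ∫⁻ x : E m, f (ρ • x) := by
  have h1 : ∫⁻ x : E m, f (ρ • x) = ∫⁻ x, f x ∂(Measure.map (fun x : E m => ρ • x) volume) :=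
    (lintegral_map_equiv f (MeasurableEquiv.smul₀ ρ hρ.ne')).symm
  rw [h1, Measure.map_addHaar_smul _ hρ.ne', lintegral_smul_measure, smul_eq_mul, ← mul_assoc,
    ← ENNReal.ofReal_mul (by positivity), finrank_euclideanSpace_fin, abs_of_pos (by positivity),
    mul_inv_cancel₀ (by positivity)]
  simp

theorem exchange_scale (A S : Set (E m)) (hA : MeasurableSet A) (hS : MeasurableSet S)
    {ρ : ℝ} (hρ : 0 < ρ) (t : ℝ) :
    exchange ((fun x => ρ⁻¹ • x) ⁻¹' A) ((fun x => ρ⁻¹ • x) ⁻¹' S) t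
      = ∫⁻ x in A, ∫⁻ y in S, ENNReal.ofReal (ρ ^ (2 * m)) * gaussKernel t (ρ • (x - y)) := by
  have hpre : ∀ {T : Set (E m)}, MeasurableSet T → MeasurableSet ((fun x => ρ⁻¹ • x) ⁻¹' T) :=
    fun hT => (measurable_const_smul (ρ⁻¹ : ℝ)) hT
  have hset : ∀ {T : Set (E m)}, MeasurableSet T → ∀ f : E m → ℝ≥0∞,
      ∫⁻ x in (fun x => ρ⁻¹ • x) ⁻¹' T, f x
        = ENNReal.ofReal (ρ ^ m) * ∫⁻ x in T, f (ρ • x) := by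
    intro T hT f
    rw [← lintegral_indicator (hpre hT), lintegral_comp_smul_eq _ hρ, ← lintegral_indicator hT]
    congr 1
    refine lintegral_congr fun x => ?_
    by_cases hx : x ∈ T
    · rw [Set.indicator_of_mem hx, Set.indicator_of_mem]
      simpa [smul_smul, inv_mul_cancel₀ hρ.ne'] using hx
    · rw [Set.indicator_of_notMem hx, Set.indicator_of_notMem]
      simpa [smul_smul, inv_mul_cancel₀ hρ.ne'] using hx
  unfold exchange
  rw [hset hA]
  simp_rw [hset hS]
  rw [← lintegral_const_mul' _ _ ENNReal.ofReal_ne_top]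
  refine lintegral_congr fun x => ?_
  rw [← mul_assoc, ← ENNReal.ofReal_mul (by positivity), ← pow_add, ← two_mul,
    ← lintegral_const_mul' _ _ ENNReal.ofReal_ne_top]
  simp_rw [smul_sub]

theorem preimage_smul_ball {ρ : ℝ} (hρ : 0 < ρ) :
    (fun x : E m => ρ⁻¹ • x) ⁻¹' Metric.ball 0 1 = Metric.ball 0 ρ := by
  ext x
  rw [Set.mem_preimage, mem_ball_zero_iff, mem_ball_zero_iff, norm_smul, norm_inv,
    Real.norm_of_nonneg hρ.le, inv_mul_lt_iff₀ hρ, mul_one]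

/-- The substitution of `x⁻¹` for `x` turns this into the standard Gamma integral; `1 < q` is
convergence at infinity. -/
theorem integral_rpow_neg_mul_exp {p q b : ℝ} (hp : 0 < p) (hq : 1 < q) (hb : 0 < b) :
    ∫ x in Set.Ioi (0 : ℝ), x ^ (-q) * Real.exp (-b * x ^ (-p))
      = b ^ (-(q - 1) / p) * (1 / p) * Real.Gamma ((q - 1) / p) := by
  have h1 := integral_rpow_mul_exp_neg_mul_rpow (p := p) (q := q - 2) hp (by linarith) hb
  rw [show q - 2 + 1 = q - 1 by ring] at h1
  rw [← h1, ← integral_comp_rpow_Ioi _ (show (-1 : ℝ) ≠ 0 by norm_num)]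
  refine setIntegral_congr_fun measurableSet_Ioi fun x hx => ?_
  have hx : 0 < x := hx
  simp only [smul_eq_mul, abs_neg, abs_one, one_mul]
  rw [← Real.rpow_mul hx.le, ← Real.rpow_mul hx.le, ← mul_assoc, ← Real.rpow_add hx]
  ring_nf

theorem lintegral_rpow_neg_mul_exp {p q b : ℝ} (hp : 0 < p) (hq : 1 < q) (hb : 0 < b) :
    ∫⁻ x in Set.Ioi (0 : ℝ), ENNReal.ofReal (x ^ (-q) * Real.exp (-b * x ^ (-p)))
      = ENNReal.ofReal (b ^ (-(q - 1) / p) * (1 / p) * Real.Gamma ((q - 1) / p)) := by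
  have h := integral_rpow_neg_mul_exp hp hq hb
  have hpos : 0 < b ^ (-(q - 1) / p) * (1 / p) * Real.Gamma ((q - 1) / p) := by
    have : 0 < Real.Gamma ((q - 1) / p) := Real.Gamma_pos_of_pos (div_pos (by linarith) hp)
    positivity
  rw [← h, ofReal_integral_eq_lintegral_ofReal]
  · by_contra hcon
    rw [integral_undef hcon] at h
    linarith
  · refine (ae_restrict_mem measurableSet_Ioi).mono fun x hx => ?_
    have hx : 0 < x := hx
    positivity

/-- The integrand is a constant times `s ^ (-(2 * m * α)) * exp (-b * s ^ (-(2 * α)))` with `b`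
proportional to `‖h‖ ^ 2 / t`. The Gamma integral returns `b ^ (1 / (2 * α) - m)`, which carries the
power of `‖h‖` and, with the kernel prefactor, the power of `t`. -/
theorem lintegral_scaled_gaussKernel {a α t : ℝ} (ha : 0 < a) (hα : 0 < α) (ht : 0 < t)
    (hmα : 1 < 2 * m * α) {h : E m} (hh : h ≠ 0) :
    ∫⁻ s in Set.Ioi (0 : ℝ), ENNReal.ofReal ((a * s ^ (-α)) ^ (2 * m)) *
        gaussKernel t ((a * s ^ (-α)) • h)
      = ENNReal.ofReal (prefactor m a α * t ^ ((m * α - 1) / (2 * α))) *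
        ENNReal.ofReal (‖h‖ ^ ((1 - 2 * m * α) / α)) := by
  have hn : 0 < ‖h‖ := norm_pos_iff.2 hh
  set b := a ^ 2 * ‖h‖ ^ 2 / (4 * t) with hb
  have hbpos : 0 < b := by positivity
  set K := a ^ (2 * m) * (4 * Real.pi * t) ^ (-(m : ℝ) / 2) with hK
  have hpt : ∀ s ∈ Set.Ioi (0 : ℝ), ENNReal.ofReal ((a * s ^ (-α)) ^ (2 * m)) *
        gaussKernel t ((a * s ^ (-α)) • h) = ENNReal.ofReal K *
          ENNReal.ofReal (s ^ (-(2 * m * α)) * Real.exp (-b * s ^ (-(2 * α)))) := by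
    intro s hs
    have hs : 0 < s := hs
    unfold gaussKernel
    rw [← ENNReal.ofReal_mul (by positivity), ← ENNReal.ofReal_mul (by positivity)]
    congr 1
    have e1 : s ^ (-(2 * m * α)) = (s ^ (-α)) ^ (2 * m) := by
      rw [← Real.rpow_natCast, ← Real.rpow_mul hs.le]
      congr 1; push_cast; ring
    have e2 : s ^ (-(2 * α)) = (s ^ (-α)) ^ 2 := by
      rw [← Real.rpow_natCast, ← Real.rpow_mul hs.le]
      congr 1; push_cast; ring
    rw [e1, e2, norm_smul, Real.norm_of_nonneg (by positivity), hb, hK, mul_pow,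
      show -(a * s ^ (-α) * ‖h‖) ^ 2 / (4 * t)
        = -(a ^ 2 * ‖h‖ ^ 2 / (4 * t)) * (s ^ (-α)) ^ 2 by ring]
    ring
  rw [setLIntegral_congr_fun measurableSet_Ioi hpt,
    lintegral_const_mul' _ _ ENNReal.ofReal_ne_top,
    lintegral_rpow_neg_mul_exp (by positivity) hmα hbpos, ← ENNReal.ofReal_mul (by positivity),
    ← ENNReal.ofReal_mul' (by positivity)]
  congr 1
  have e0 : -(2 * (m : ℝ) * α - 1) / (2 * α) = 1 / (2 * α) - m := by field_simp; ring
  have e1 : b ^ (-(2 * (m : ℝ) * α - 1) / (2 * α))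
      = a ^ (1 / α) * (a ^ (2 * m))⁻¹ * ‖h‖ ^ ((1 - 2 * m * α) / α)
        * (4 * t) ^ ((m : ℝ) - 1 / (2 * α)) := by
    have ea : (a ^ 2) ^ (1 / (2 * α) - (m : ℝ)) = a ^ (1 / α) * (a ^ (2 * m))⁻¹ := by
      rw [← Real.rpow_natCast, ← Real.rpow_natCast, ← Real.rpow_mul ha.le, ← Real.rpow_neg ha.le,
        ← Real.rpow_add ha]
      congr 1
      push_cast
      field_simp
      ring
    have eh : (‖h‖ ^ 2) ^ (1 / (2 * α) - (m : ℝ)) = ‖h‖ ^ ((1 - 2 * m * α) / α) := by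
      rw [← Real.rpow_natCast, ← Real.rpow_mul hn.le]
      congr 1
      push_cast
      field_simp
    rw [e0, hb, Real.div_rpow (by positivity) (by positivity),
      Real.mul_rpow (by positivity) (by positivity), ea, eh,
      show (m : ℝ) - 1 / (2 * α) = -(1 / (2 * α) - m) by ring, Real.rpow_neg (by positivity)]
    ring
  have e2 : (4 * Real.pi * t) ^ (-(m : ℝ) / 2) * (4 * t) ^ ((m : ℝ) - 1 / (2 * α)) * (1 / (2 * α))
      = (2 : ℝ) ^ ((m : ℝ) - 1 - 1 / α) * Real.pi ^ (-(m : ℝ) / 2) * α⁻¹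
        * t ^ ((m * α - 1) / (2 * α)) := by
    have e3 : (4 * t) ^ (-(m : ℝ) / 2) * (4 * t) ^ ((m : ℝ) - 1 / (2 * α))
        = (4 * t) ^ ((m * α - 1) / (2 * α)) := by
      rw [← Real.rpow_add (by positivity)]
      congr 1
      field_simp
      ring
    have e4 : (4 : ℝ) ^ ((m * α - 1) / (2 * α)) = 2 * 2 ^ ((m : ℝ) - 1 - 1 / α) := by
      rw [show (4 : ℝ) = 2 ^ (2 : ℝ) by norm_num, ← Real.rpow_mul (by norm_num)]
      rw [show (m : ℝ) - 1 - 1 / α = 2 * ((m * α - 1) / (2 * α)) - 1 by field_simp; ring,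
        Real.rpow_sub_one (by norm_num)]
      ring
    rw [show 4 * Real.pi * t = Real.pi * (4 * t) by ring,
      Real.mul_rpow (by positivity) (by positivity), mul_assoc (Real.pi ^ _), e3,
      Real.mul_rpow (by positivity) (by positivity), e4]
    field_simp
  rw [e1, hK, prefactor]
  have ha2 : a ^ (2 * m) ≠ 0 := by positivity
  calc _ = ((4 * Real.pi * t) ^ (-(m : ℝ) / 2) * (4 * t) ^ ((m : ℝ) - 1 / (2 * α))
        * (1 / (2 * α))) * (a ^ (2 * m) * (a ^ (2 * m))⁻¹) * a ^ (1 / α)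
        * ‖h‖ ^ ((1 - 2 * m * α) / α) * Real.Gamma ((2 * m * α - 1) / (2 * α)) := by ring
    _ = _ := by
        rw [e2, mul_inv_cancel₀ ha2]
        ring

/-- Integrating the exchange over a family of dilations with power-law ratio gives a multiple of
a double integral of a power of the distance. -/
theorem lintegral_exchange_dilated (hm : 0 < m) {a α t : ℝ} (ha : 0 < a) (hα : 0 < α)
    (ht : 0 < t) (hmα : 1 < 2 * m * α) (A S : Set (E m)) (hA : MeasurableSet A)
    (hS : MeasurableSet S) :
    ∫⁻ s in Set.Ioi (0 : ℝ), exchange ((fun x => (a * s ^ (-α))⁻¹ • x) ⁻¹' A)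
        ((fun x => (a * s ^ (-α))⁻¹ • x) ⁻¹' S) t
      = ENNReal.ofReal (prefactor m a α * t ^ ((m * α - 1) / (2 * α))) *
        doubleIntegral A S ((1 - 2 * m * α) / α) := by
  have : Nonempty (Fin m) := ⟨⟨0, hm⟩⟩
  let F : ℝ → E m → ℝ≥0∞ := fun s h => ENNReal.ofReal ((a * s ^ (-α)) ^ (2 * m)) *
        gaussKernel t ((a * s ^ (-α)) • h)
  have hF : Measurable (Function.uncurry F) := by
    refine Measurable.mul (ENNReal.measurable_ofReal.comp (by fun_prop)) ?_
    exact (measurable_gaussKernel t).comp (by fun_prop)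
  calc _ = ∫⁻ s in Set.Ioi (0 : ℝ), ∫⁻ x in A, ∫⁻ y in S, F s (x - y) :=
        setLIntegral_congr_fun measurableSet_Ioi fun s hs => by
          have hs : 0 < s := hs
          exact exchange_scale A S hA hS (by positivity) t
    _ = ∫⁻ x in A, ∫⁻ s in Set.Ioi (0 : ℝ), ∫⁻ y in S, F s (x - y) := by
        refine lintegral_lintegral_swap (Measurable.aemeasurable ?_)
        refine Measurable.lintegral_prod_right'
          (f := fun p : (ℝ × E m) × E m => F p.1.1 (p.1.2 - p.2)) ?_
        exact hF.comp (f := fun p : (ℝ × E m) × E m => (p.1.1, p.1.2 - p.2)) (by fun_prop)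
    _ = ∫⁻ x in A, ∫⁻ y in S, ∫⁻ s in Set.Ioi (0 : ℝ), F s (x - y) := by
        refine lintegral_congr fun x => lintegral_lintegral_swap (Measurable.aemeasurable ?_)
        exact hF.comp (f := fun p : ℝ × E m => (p.1, x - p.2)) (by fun_prop)
    _ = ∫⁻ x in A, ∫⁻ y in S, ENNReal.ofReal (prefactor m a α * t ^ ((m * α - 1) / (2 * α))) *
        ENNReal.ofReal (‖x - y‖ ^ ((1 - 2 * m * α) / α)) := by
        refine lintegral_congr fun x => lintegral_congr_ae ?_
        refine ae_restrict_of_ae ?_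
        -- The diagonal, where the pointwise formula is not available, is a null set because the
        -- dimension is positive.
        have : ∀ᵐ y : E m, y ≠ x := by
          rw [ae_iff]
          simp
        filter_upwards [this] with y hy
        exact lintegral_scaled_gaussKernel ha hα ht hmα (sub_ne_zero.2 hy.symm)
    _ = _ := by
        unfold doubleIntegral
        simp_rw [lintegral_const_mul' _ _ ENNReal.ofReal_ne_top]

/-! ### Perimeter of a disjoint union of balls -/

theorem continuous_divergence {φ : E m → E m} (hφ : ContDiff ℝ 1 φ) :
    Continuous (divergence φ) := by
  unfold divergence
  refine continuous_finsetSum _ fun i _ => ?_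
  have h : Continuous fun x => fderiv ℝ φ x (EuclideanSpace.single i 1) :=
    (hφ.continuous_fderiv (by simp)).clm_apply continuous_const
  fun_prop

theorem hasCompactSupport_divergence {φ : E m → E m} (hφ : HasCompactSupport φ) :
    HasCompactSupport (divergence φ) := by
  refine (hφ.fderiv ℝ).comp_left
    (g := fun L : E m →L[ℝ] E m => ∑ i : Fin m, (L (EuclideanSpace.single i 1)) i) ?_
  simp

theorem fderiv_coord {φ : E m → E m} (hφ : ContDiff ℝ 1 φ) (i : Fin m) (x v : E m) :
    fderiv ℝ (fun y => φ y i) x v = (fderiv ℝ φ x v) i := by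
  have h := ((EuclideanSpace.proj (𝕜 := ℝ) i).hasFDerivAt (x := φ x)).comp x
    ((hφ.differentiable (by simp)) x).hasFDerivAt
  have h' : HasFDerivAt (fun y => φ y i) ((EuclideanSpace.proj (𝕜 := ℝ) i).comp (fderiv ℝ φ x)) x :=
    h
  rw [h'.fderiv]
  rfl

/-- Integration by parts against a Lipschitz function. -/
theorem integral_mul_divergence_eq {η : E m → ℝ} {C : NNReal} (hη : LipschitzWith C η)
    {φ : E m → E m} (hφ : ContDiff ℝ 1 φ) (hc : HasCompactSupport φ) :
    ∫ x, divergence φ x * η x = -∫ x, fderiv ℝ η x (φ x) := by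
  have hci : ∀ i : Fin m, ContDiff ℝ 1 fun x => φ x i := fun i =>
    (EuclideanSpace.proj (𝕜 := ℝ) i).contDiff.comp hφ
  have hcs : ∀ i : Fin m, HasCompactSupport fun x => φ x i := fun i =>
    hc.comp_left (g := fun v : E m => v i) rfl
  have key : ∀ i : Fin m, ∫ x, lineDeriv ℝ η x (EuclideanSpace.single i 1) * φ x i
      = -∫ x, (fderiv ℝ φ x (EuclideanSpace.single i 1)) i * η x := by
    intro i
    obtain ⟨D, hD⟩ := ContDiff.lipschitzWith_of_hasCompactSupport (hcs i) (hci i) (by simp)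
    rw [hη.integral_lineDeriv_mul_eq hD (hcs i), ← integral_neg]
    refine integral_congr_ae (Eventually.of_forall fun x => ?_)
    have hd : DifferentiableAt ℝ (fun y => φ y i) x := (hci i).differentiable (by simp) x
    simp only
    rw [hd.lineDeriv_eq_fderiv, fderiv_coord hφ]
    simp
  have hint1 : ∀ i ∈ (Finset.univ : Finset (Fin m)),
      Integrable fun x => (fderiv ℝ φ x (EuclideanSpace.single i 1)) i * η x := by
    intro i _
    refine Continuous.integrable_of_hasCompactSupport ?_ ?_
    · have h : Continuous fun x => fderiv ℝ φ x (EuclideanSpace.single i 1) :=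
        (hφ.continuous_fderiv (by simp)).clm_apply continuous_const
      have := hη.continuous
      fun_prop
    · exact ((hc.fderiv ℝ).comp_left
        (g := fun L : E m →L[ℝ] E m => (L (EuclideanSpace.single i 1)) i) rfl).mul_right
  have hint2 : ∀ i ∈ (Finset.univ : Finset (Fin m)),
      Integrable fun x => lineDeriv ℝ η x (EuclideanSpace.single i 1) * φ x i := fun i _ =>
    ((hci i).continuous.integrable_of_hasCompactSupport (hcs i)).smul_of_top_right
      (hη.memLp_lineDeriv (EuclideanSpace.single i 1))
  calc ∫ x, divergence φ x * η x
      = ∑ i : Fin m, ∫ x, (fderiv ℝ φ x (EuclideanSpace.single i 1)) i * η x := by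
        rw [← integral_finsetSum _ hint1]
        simp_rw [divergence, Finset.sum_mul]
    _ = -∑ i : Fin m, ∫ x, lineDeriv ℝ η x (EuclideanSpace.single i 1) * φ x i := by
        simp_rw [key, Finset.sum_neg_distrib, neg_neg]
    _ = -∫ x, ∑ i : Fin m, lineDeriv ℝ η x (EuclideanSpace.single i 1) * φ x i := by
        rw [integral_finsetSum _ hint2]
    _ = _ := by
        congr 1
        refine integral_congr_ae ?_
        -- Rademacher's theorem: almost everywhere the line derivatives assemble into a linear
        -- derivative.
        filter_upwards [hη.ae_differentiableAt] with x hx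
        have hsum : φ x = ∑ i : Fin m, φ x i • EuclideanSpace.single i (1 : ℝ) := by
          have := (EuclideanSpace.basisFun (Fin m) ℝ).sum_repr (φ x)
          simpa using this.symm
        conv_rhs => rw [hsum, map_sum]
        refine Finset.sum_congr rfl fun i _ => ?_
        rw [hx.lineDeriv_eq_fderiv, map_smul, smul_eq_mul, mul_comm]

/-- The piecewise linear radial cutoff, equal to `1` on the ball of radius `r` and to `0` outside
the ball of radius `r + ε`. -/
def radialCutoff (c : E m) (r ε : ℝ) (x : E m) : ℝ := max 0 (min 1 (1 - (dist x c - r) / ε))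

theorem lipschitzWith_radialCutoff (c : E m) (r : ℝ) {ε : ℝ} (hε : 0 < ε) :
    LipschitzWith (Real.toNNReal ε⁻¹) (radialCutoff c r ε) := by
  refine LipschitzWith.const_max (LipschitzWith.const_min ?_ 1) 0
  refine LipschitzWith.of_dist_le_mul fun x y => ?_
  rw [Real.coe_toNNReal _ (by positivity), Real.dist_eq,
    show 1 - (dist x c - r) / ε - (1 - (dist y c - r) / ε) = -(ε⁻¹ * (dist x c - dist y c)) by
      field_simp; ring,
    abs_neg, abs_mul, abs_of_pos (by positivity : 0 < ε⁻¹)]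
  gcongr
  exact abs_dist_sub_le _ _ _

theorem radialCutoff_nonneg (c : E m) (r ε : ℝ) (x : E m) : 0 ≤ radialCutoff c r ε x :=
  le_max_left _ _

theorem radialCutoff_le_one (c : E m) (r ε : ℝ) (x : E m) : radialCutoff c r ε x ≤ 1 :=
  max_le zero_le_one (min_le_left _ _)

theorem radialCutoff_eq_one (c : E m) {r ε : ℝ} (hε : 0 < ε) {x : E m}
    (hx : x ∈ Metric.ball c r) : radialCutoff c r ε x = 1 := by
  have h : (dist x c - r) / ε ≤ 0 :=
    div_nonpos_of_nonpos_of_nonneg (by linarith [Metric.mem_ball.1 hx]) hε.le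
  rw [radialCutoff, min_eq_left (by linarith), max_eq_right zero_le_one]

theorem radialCutoff_eq_zero (c : E m) {r ε : ℝ} (hε : 0 < ε) {x : E m}
    (hx : r + ε ≤ dist x c) : radialCutoff c r ε x = 0 := by
  have h : 1 ≤ (dist x c - r) / ε := by
    rw [le_div_iff₀ hε]; linarith
  rw [radialCutoff, max_eq_left]
  exact (min_le_right _ _).trans (by linarith)

theorem fderiv_radialCutoff_eq_zero (c : E m) {r ε : ℝ} (hε : 0 < ε) {x : E m}
    (hx : x ∉ Metric.closedBall c (r + ε) \ Metric.ball c r) :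
    fderiv ℝ (radialCutoff c r ε) x = 0 := by
  by_cases h1 : x ∈ Metric.ball c r
  · have : radialCutoff c r ε =ᶠ[𝓝 x] fun _ => 1 := by
      filter_upwards [Metric.isOpen_ball.mem_nhds h1] with y hy
      exact radialCutoff_eq_one c hε hy
    rw [this.fderiv_eq]
    simp
  · have h2 : x ∈ (Metric.closedBall c (r + ε))ᶜ := fun h => hx ⟨h, h1⟩
    have : radialCutoff c r ε =ᶠ[𝓝 x] fun _ => 0 := by
      filter_upwards [Metric.isClosed_closedBall.isOpen_compl.mem_nhds h2] with y hy
      rw [Set.mem_compl_iff, Metric.mem_closedBall, not_le] at hy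
      exact radialCutoff_eq_zero c hε hy.le
    rw [this.fderiv_eq]
    simp

theorem volume_annulus_le (c : E m) (hm : 0 < m) {r ε : ℝ} (hr : 0 ≤ r) (hε : 0 < ε) :
    (volume (Metric.closedBall c (r + ε) \ Metric.ball c r)).toReal
      ≤ unitSphereArea m * (r + ε) ^ (m - 1) * ε := by
  have : Nonempty (Fin m) := ⟨⟨0, hm⟩⟩
  have hω := (unitBallVolume_pos m).le
  rw [measure_sdiff (Metric.ball_subset_closedBall.trans
      (Metric.closedBall_subset_closedBall (by linarith)))
    measurableSet_ball.nullMeasurableSet measure_ball_lt_top.ne,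
    Measure.addHaar_closedBall_eq_addHaar_ball, volume_ball_eq _ (by positivity) hm,
    volume_ball_eq _ hr hm, ← ENNReal.ofReal_sub _ (by positivity), ← mul_sub]
  obtain ⟨k, rfl⟩ : ∃ k, m = k + 1 := ⟨m - 1, by omega⟩
  have h := pow_sub_pow_le_mul hr (by linarith : r ≤ r + ε) k
  rw [unitSphereArea]
  rw [ENNReal.toReal_ofReal]
  · calc _ ≤ unitBallVolume (k + 1) * (((k : ℝ) + 1) * (r + ε) ^ k * (r + ε - r)) := by gcongr
      _ = _ := by
        rw [Nat.add_sub_cancel]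
        push_cast
        ring
  · apply mul_nonneg hω
    have := pow_le_pow_left₀ hr (by linarith : r ≤ r + ε) (k + 1)
    linarith

/-- The flux of a vector field of length at most one out of a ball is at most the area of the
sphere. -/
theorem integral_ball_divergence_le (hm : 0 < m) (c : E m) {r : ℝ} (hr : 0 ≤ r) {φ : E m → E m}
    (hφ : ContDiff ℝ 1 φ) (hc : HasCompactSupport φ) (h1 : ∀ x, ‖φ x‖ ≤ 1) :
    ∫ x in Metric.ball c r, divergence φ x ≤ unitSphereArea m * r ^ (m - 1) := by
  have hσ : 0 ≤ unitSphereArea m := mul_nonneg (Nat.cast_nonneg m) (unitBallVolume_pos m).le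
  have hcont := continuous_divergence hφ
  have hcs := hasCompactSupport_divergence hc
  obtain ⟨M, hM⟩ := hcs.exists_bound_of_continuous hcont
  have hM0 : 0 ≤ M := (norm_nonneg _).trans (hM c)
  have hint : Integrable (divergence φ) := hcont.integrable_of_hasCompactSupport hcs
  -- The indicator of the ball is replaced by the cutoff at scale `ε`. After integration by parts
  -- the main term is at most `ε⁻¹` times the volume of the annulus, and the replacement costs at
  -- most `M` times that volume. The volume is of order `ε`, so letting `ε → 0` leaves the sphere
  -- area.
  have hbound : ∀ ε : ℝ, 0 < ε → ∫ x in Metric.ball c r, divergence φ x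
      ≤ unitSphereArea m * (r + ε) ^ (m - 1) * (1 + M * ε) := by
    intro ε hε
    set A := Metric.closedBall c (r + ε) \ Metric.ball c r with hA
    have hAm : MeasurableSet A := measurableSet_closedBall.diff measurableSet_ball
    have hAfin : volume A < ⊤ := (measure_mono Set.sdiff_subset).trans_lt measure_closedBall_lt_top
    have hvol := volume_annulus_le c hm hr hε
    rw [← hA] at hvol
    set η := radialCutoff c r ε with hη
    have hlip := lipschitzWith_radialCutoff c r hε
    have hint2 : Integrable fun x => divergence φ x * η x :=
      (hcont.mul hlip.continuous).integrable_of_hasCompactSupport hcs.mul_right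
    have hindint : ∀ b : ℝ, Integrable (A.indicator fun _ => b) := fun b =>
      (integrableOn_const hAfin.ne).integrable_indicator hAm
    have hindval : ∀ b : ℝ, ∫ x, A.indicator (fun _ => b) x = b * (volume A).toReal := fun b => by
      rw [integral_indicator hAm, setIntegral_const, smul_eq_mul, mul_comm]
      rfl
    have hI1 : ∫ x, divergence φ x * η x ≤ ε⁻¹ * (volume A).toReal := by
      rw [integral_mul_divergence_eq hlip hφ hc, ← hindval]
      refine (neg_le_abs _).trans ?_
      rw [← Real.norm_eq_abs]
      refine norm_integral_le_of_norm_le (hindint _) (Eventually.of_forall fun x => ?_)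
      by_cases hx : x ∈ A
      · rw [Set.indicator_of_mem hx]
        calc ‖fderiv ℝ η x (φ x)‖ ≤ ‖fderiv ℝ η x‖ * ‖φ x‖ := ContinuousLinearMap.le_opNorm _ _
          _ ≤ ε⁻¹ * 1 := by
            gcongr
            · have := norm_fderiv_le_of_lipschitz ℝ hlip (x₀ := x)
              rwa [Real.coe_toNNReal _ (by positivity)] at this
            · exact h1 x
          _ = ε⁻¹ := mul_one _
      · rw [Set.indicator_of_notMem hx, fderiv_radialCutoff_eq_zero c hε hx]
        simp
    have hI2 : (∫ x in Metric.ball c r, divergence φ x) - ∫ x, divergence φ x * η x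
        ≤ M * (volume A).toReal := by
      rw [← integral_indicator measurableSet_ball,
        ← integral_sub (hint.indicator measurableSet_ball) hint2, ← hindval]
      refine (le_abs_self _).trans ?_
      rw [← Real.norm_eq_abs]
      refine norm_integral_le_of_norm_le (hindint _) (Eventually.of_forall fun x => ?_)
      by_cases hxb : x ∈ Metric.ball c r
      · rw [Set.indicator_of_mem hxb, hη, radialCutoff_eq_one c hε hxb, mul_one, sub_self, norm_zero]
        exact Set.indicator_nonneg (fun _ _ => hM0) _
      · rw [Set.indicator_of_notMem hxb, zero_sub, norm_neg, norm_mul]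
        by_cases hx : x ∈ A
        · rw [Set.indicator_of_mem hx]
          calc ‖divergence φ x‖ * ‖η x‖ ≤ M * 1 := by
                gcongr
                · exact hM x
                · rw [Real.norm_of_nonneg (radialCutoff_nonneg _ _ _ _)]
                  exact radialCutoff_le_one _ _ _ _
            _ = M := mul_one M
        · rw [Set.indicator_of_notMem hx]
          have : r + ε ≤ dist x c := by
            by_contra hcon
            exact hx ⟨Metric.mem_closedBall.2 (not_le.1 hcon).le, hxb⟩
          rw [hη, radialCutoff_eq_zero c hε this]
          simp
    calc _ ≤ ε⁻¹ * (volume A).toReal + M * (volume A).toReal := by linarith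
      _ = (ε⁻¹ + M) * (volume A).toReal := by ring
      _ ≤ (ε⁻¹ + M) * (unitSphereArea m * (r + ε) ^ (m - 1) * ε) := by gcongr
      _ = _ := by field_simp
  have hlim : Tendsto (fun ε : ℝ => unitSphereArea m * (r + ε) ^ (m - 1) * (1 + M * ε)) (𝓝[>] 0)
      (𝓝 (unitSphereArea m * r ^ (m - 1))) := by
    have : Continuous fun ε : ℝ => unitSphereArea m * (r + ε) ^ (m - 1) * (1 + M * ε) := by
      fun_prop
    have h := this.tendsto 0
    simp only [add_zero, mul_zero, mul_one] at h
    exact h.mono_left nhdsWithin_le_nhds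
  exact ge_of_tendsto hlim (eventually_mem_nhdsWithin.mono fun ε hε => hbound ε hε)

/-- The terms are fluxes and may be negative; `ENNReal.ofReal` then truncates them to `0`, which
only enlarges the right-hand side. -/
theorem ofReal_hasSum_le_tsum {ι : Type*} {f : ι → ℝ} {s : ℝ} (h : HasSum f s) :
    ENNReal.ofReal s ≤ ∑' i, ENNReal.ofReal (f i) := by
  refine le_of_tendsto ((ENNReal.continuous_ofReal.tendsto s).comp h)
    (Eventually.of_forall fun F => ?_)
  calc ENNReal.ofReal (∑ i ∈ F, f i) ≤ ENNReal.ofReal (∑ i ∈ F, max (f i) 0) :=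
        ENNReal.ofReal_le_ofReal (Finset.sum_le_sum fun i _ => le_max_left _ _)
    _ = ∑ i ∈ F, ENNReal.ofReal (max (f i) 0) :=
        ENNReal.ofReal_sum_of_nonneg fun i _ => le_max_right _ _
    _ = ∑ i ∈ F, ENNReal.ofReal (f i) :=
        Finset.sum_congr rfl fun i _ => by simp
    _ ≤ _ := ENNReal.sum_le_tsum F

theorem perimeter_iUnion_ball_le {ι : Type*} [Countable ι] (hm : 0 < m) (c : ι → E m) (r : ι → ℝ)
    (hr : ∀ i, 0 ≤ r i)
    (hd : Pairwise (Function.onFun Disjoint fun i => Metric.ball (c i) (r i))) :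
    perimeter (⋃ i, Metric.ball (c i) (r i))
      ≤ ∑' i, ENNReal.ofReal (unitSphereArea m * r i ^ (m - 1)) := by
  unfold perimeter
  refine iSup_le fun φ => iSup_le fun hφ => iSup_le fun hc => iSup_le fun h1 => ?_
  have hint : Integrable (divergence φ) :=
    (continuous_divergence hφ).integrable_of_hasCompactSupport (hasCompactSupport_divergence hc)
  refine (ofReal_hasSum_le_tsum (hasSum_integral_iUnion (fun i => measurableSet_ball) hd
    hint.integrableOn)).trans (ENNReal.tsum_le_tsum fun i => ?_)
  exact ENNReal.ofReal_le_ofReal (integral_ball_divergence_le hm _ (hr i) hφ hc h1)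

theorem divergence_congr {φ ψ : E m → E m} {x : E m} (h : φ =ᶠ[𝓝 x] ψ) :
    divergence φ x = divergence ψ x := by
  simp_rw [divergence, h.fderiv_eq]

theorem divergence_smul_sub (k : ℝ) (c x : E m) :
    divergence (fun y => k • (y - c)) x = m * k := by
  have h : HasFDerivAt (fun y : E m => k • (y - c)) (k • ContinuousLinearMap.id ℝ (E m)) x :=
    ((hasFDerivAt_id x).sub_const c).const_smul k
  simp_rw [divergence, h.fderiv]
  simp

/-- For finitely many balls the test field is `(x - c i) / ((1 + δ) * r i)` times a bump equal to
`1` on the ball. Its flux through the `i`-th ball is the sphere area divided by `1 + δ`. The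
supports lie in disjoint balls of radius `1 / 2`, so summing the fields keeps the length at most
one; then `δ → 0`. -/
theorem le_perimeter_iUnion_ball {ι : Type*} [Countable ι] (hm : 0 < m) (c : ι → E m) (r : ι → ℝ)
    (hr : ∀ i, 0 < r i) (hr' : ∀ i, r i ≤ 1 / 4) (hc : ∀ i j, i ≠ j → 1 ≤ dist (c i) (c j)) :
    ∑' i, ENNReal.ofReal (unitSphereArea m * r i ^ (m - 1))
      ≤ perimeter (⋃ i, Metric.ball (c i) (r i)) := by
  classical
  have hσ : 0 ≤ unitSphereArea m := mul_nonneg (Nat.cast_nonneg m) (unitBallVolume_pos m).le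
  rw [ENNReal.tsum_eq_iSup_sum]
  refine iSup_le fun s => ?_
  rw [← ENNReal.ofReal_sum_of_nonneg fun i _ => by have := hr i; positivity]
  set T := ∑ i ∈ s, unitSphereArea m * r i ^ (m - 1) with hT
  have hsub : ∀ i, Metric.ball (c i) (r i) ⊆ Metric.ball (c i) (1 / 2) := fun i =>
    Metric.ball_subset_ball (by linarith [hr' i])
  have hdisj : ∀ i j, i ≠ j → Disjoint (Metric.ball (c i) (1 / 2)) (Metric.ball (c j) (1 / 2)) :=
    fun i j hij => Metric.ball_disjoint_ball (by linarith [hc i j hij])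
  have key : ∀ δ : ℝ, 0 < δ → δ ≤ 1 → ENNReal.ofReal ((1 + δ)⁻¹ * T)
      ≤ perimeter (⋃ i, Metric.ball (c i) (r i)) := by
    intro δ hδ hδ1
    -- The bump needs room outside the ball. Its outer radius `(1 + δ) * r i` is the normalising
    -- factor of the field, which keeps its length at most one, and it is at most `1 / 2` because `δ
    -- ≤ 1` and `r i ≤ 1 / 4`.
    let χ : ∀ i, ContDiffBump (c i) := fun i =>
      ⟨r i, (1 + δ) * r i, hr i, by nlinarith [hr i]⟩
    have hout : ∀ i, (χ i).rOut ≤ 1 / 2 := fun i => by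
      change (1 + δ) * r i ≤ 1 / 2
      nlinarith [hr i, hr' i]
    have hχ0 : ∀ i x, x ∉ Metric.ball (c i) (1 / 2) → χ i x = 0 := fun i x hx =>
      (χ i).zero_of_le_dist ((hout i).trans (not_lt.1 hx))
    let ψ : ι → E m → E m := fun i x => χ i x • (((1 + δ) * r i)⁻¹ • (x - c i))
    have hψ0 : ∀ i x, x ∉ Metric.ball (c i) (1 / 2) → ψ i x = 0 := fun i x hx => by
      simp [ψ, hχ0 i x hx]
    have hψ1 : ∀ i x, ‖ψ i x‖ ≤ 1 := by
      intro i x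
      have hρ : 0 < (1 + δ) * r i := mul_pos (by linarith) (hr i)
      by_cases hx : x ∈ Metric.ball (c i) ((1 + δ) * r i)
      · rw [norm_smul, norm_smul, Real.norm_of_nonneg (χ i).nonneg,
          Real.norm_of_nonneg (by positivity)]
        have h2 : ‖x - c i‖ ≤ (1 + δ) * r i := (mem_ball_iff_norm.1 hx).le
        calc χ i x * (((1 + δ) * r i)⁻¹ * ‖x - c i‖)
            ≤ 1 * (((1 + δ) * r i)⁻¹ * ((1 + δ) * r i)) := by
              gcongr
              exact (χ i).le_one
          _ = 1 := by rw [one_mul, inv_mul_cancel₀ hρ.ne']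
      · have : χ i x = 0 := (χ i).zero_of_le_dist (not_lt.1 hx)
        simp [ψ, this]
    set φ : E m → E m := fun x => ∑ i ∈ s, ψ i x with hφdef
    have hφloc : ∀ j x, x ∈ Metric.ball (c j) (1 / 2) → φ x = if j ∈ s then ψ j x else 0 := by
      intro j x hx
      have hne : ∀ i ∈ s, i ≠ j → ψ i x = 0 := fun i _ hij =>
        hψ0 i x fun hxi => Set.disjoint_left.1 (hdisj i j hij) hxi hx
      rw [hφdef]
      by_cases hj : j ∈ s
      · simp only [hj, if_true]
        exact Finset.sum_eq_single j hne fun h => absurd hj h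
      · simp only [hj, if_false]
        exact Finset.sum_eq_zero fun i hi => hne i hi fun h => hj (h ▸ hi)
    have hφ1 : ∀ x, ‖φ x‖ ≤ 1 := by
      intro x
      by_cases hx : ∃ j, x ∈ Metric.ball (c j) (1 / 2)
      · obtain ⟨j, hj⟩ := hx
        rw [hφloc j x hj]
        split_ifs
        · exact hψ1 j x
        · simp
      · push Not at hx
        rw [hφdef]
        simp [Finset.sum_eq_zero fun i _ => hψ0 i x (hx i)]
    have hφc : ContDiff ℝ 1 φ := by
      refine ContDiff.sum fun i _ => ?_
      exact (χ i).contDiff.smul ((contDiff_id.sub contDiff_const).const_smul _)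
    have hφs : HasCompactSupport φ := by
      have hK : IsCompact (⋃ i ∈ s, Metric.closedBall (c i) (1 / 2)) :=
        s.finite_toSet.isCompact_biUnion fun i _ => isCompact_closedBall _ _
      refine HasCompactSupport.intro hK fun x hx => ?_
      refine Finset.sum_eq_zero fun i hi => hψ0 i x fun hxi => hx ?_
      exact Set.mem_biUnion hi (Metric.ball_subset_closedBall hxi)
    have hdiv : ∀ j, ∫ x in Metric.ball (c j) (r j), divergence φ x
        = if j ∈ s then (1 + δ)⁻¹ * (unitSphereArea m * r j ^ (m - 1)) else 0 := by
      intro j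
      have hdj : ∀ x ∈ Metric.ball (c j) (r j), divergence φ x
          = if j ∈ s then m * ((1 + δ) * r j)⁻¹ else 0 := by
        intro x hx
        have hnear : ∀ᶠ y in 𝓝 x, y ∈ Metric.ball (c j) (r j) := Metric.isOpen_ball.mem_nhds hx
        split_ifs with hj
        · rw [← divergence_smul_sub ((1 + δ) * r j)⁻¹ (c j) x]
          apply divergence_congr
          filter_upwards [hnear] with y hy
          rw [hφloc j y (hsub j hy), if_pos hj]
          simp only [ψ]
          rw [(χ j).one_of_mem_closedBall (Metric.ball_subset_closedBall hy), one_smul]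
        · have : divergence φ x = divergence (fun y => (0 : ℝ) • (y - c j)) x := by
            apply divergence_congr
            filter_upwards [hnear] with y hy
            rw [hφloc j y (hsub j hy), if_neg hj, zero_smul]
          rw [this, divergence_smul_sub, mul_zero]
      rw [setIntegral_congr_fun measurableSet_ball hdj, setIntegral_const, Measure.real,
        volume_ball_eq _ (hr j).le hm,
        ENNReal.toReal_ofReal (by have := hr j; have := unitBallVolume_pos m; positivity)]
      split_ifs
      · obtain ⟨k, rfl⟩ : ∃ k, m = k + 1 := ⟨m - 1, by omega⟩
        have := (hr j).ne'
        rw [smul_eq_mul, unitSphereArea, Nat.add_sub_cancel, pow_succ]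
        field_simp
      · simp
    have hint : Integrable (divergence φ) :=
      (continuous_divergence hφc).integrable_of_hasCompactSupport
        (hasCompactSupport_divergence hφs)
    have hval : ∫ x in ⋃ i, Metric.ball (c i) (r i), divergence φ x = (1 + δ)⁻¹ * T := by
      have h := hasSum_integral_iUnion (fun i => measurableSet_ball)
        (fun i j hij => (hdisj i j hij).mono (hsub i) (hsub j)) hint.integrableOn
      simp_rw [hdiv] at h
      have h2 : HasSum (fun j => if j ∈ s then (1 + δ)⁻¹ * (unitSphereArea m * r j ^ (m - 1)) else 0)
          (∑ j ∈ s, if j ∈ s then (1 + δ)⁻¹ * (unitSphereArea m * r j ^ (m - 1)) else 0) :=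
        hasSum_sum_of_ne_finset_zero fun j hj => if_neg hj
      rw [h.unique h2, hT, Finset.mul_sum]
      exact Finset.sum_congr rfl fun j hj => if_pos hj
    rw [← hval]
    unfold perimeter
    exact le_iSup_of_le φ (le_iSup_of_le hφc (le_iSup_of_le hφs (le_iSup_of_le hφ1 le_rfl)))
  have hlim : Tendsto (fun δ : ℝ => ENNReal.ofReal ((1 + δ)⁻¹ * T)) (𝓝[>] 0)
      (𝓝 (ENNReal.ofReal T)) := by
    have h : Tendsto (fun δ : ℝ => (1 + δ)⁻¹ * T) (𝓝 0) (𝓝 T) := by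
      have : ContinuousAt (fun δ : ℝ => (1 + δ)⁻¹ * T) 0 := by
        refine ContinuousAt.mul (ContinuousAt.inv₀ (by fun_prop) (by norm_num)) continuousAt_const
      simpa [ContinuousAt] using this
    exact (ENNReal.continuous_ofReal.tendsto T).comp (h.mono_left nhdsWithin_le_nhds)
  refine le_of_tendsto hlim ?_
  filter_upwards [Ioo_mem_nhdsGT (zero_lt_one' ℝ)] with δ hδ
  exact key δ hδ.1 hδ.2.le

/-! ### Lattice sums and the exchange between distinct balls -/

theorem latticePoint_sub (k l : Fin m → ℤ) :
    latticePoint k - latticePoint l = latticePoint (k - l) := by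
  ext j
  simp [latticePoint]

theorem one_le_norm_latticePoint {k : Fin m → ℤ} (hk : k ≠ 0) : 1 ≤ ‖latticePoint k‖ := by
  obtain ⟨j, hj⟩ := Function.ne_iff.1 hk
  have h1 : ‖(latticePoint k) j‖ ≤ ‖latticePoint k‖ := PiLp.norm_apply_le _ j
  have h2 : (1 : ℝ) ≤ ‖(latticePoint k) j‖ := by
    have : (1 : ℤ) ≤ |k j| := Int.one_le_abs hj
    simp only [latticePoint, Real.norm_eq_abs]
    exact_mod_cast this
  exact h2.trans h1

theorem latticePoint_injective : Function.Injective (latticePoint (m := m)) := by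
  intro k l h
  ext j
  have := congrArg (fun v : E m => v j) h
  simpa [latticePoint] using this

/-- The points lie in the integer span of the standard basis, a lattice of rank `m`, and the
exponent `m + 2` exceeds the rank. The origin contributes `0`, by the convention for negative real
powers of `0`. -/
theorem summable_norm_latticePoint_rpow (m : ℕ) :
    Summable fun k : Fin m → ℤ => ‖latticePoint k‖ ^ (-((m : ℝ) + 2)) := by
  let b := (EuclideanSpace.basisFun (Fin m) ℝ).toBasis
  let L : Submodule ℤ (E m) := Submodule.span ℤ (Set.range b)
  have hmem : ∀ k : Fin m → ℤ, latticePoint k ∈ L := by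
    intro k
    have : latticePoint k = ∑ i : Fin m, k i • b i := by
      ext j
      simp [latticePoint, b, Pi.single_apply]
    rw [this]
    exact Submodule.sum_mem _ fun i _ =>
      Submodule.smul_mem _ _ (Submodule.subset_span (Set.mem_range_self i))
  have hrank : Module.finrank ℤ L = m := by
    rw [ZLattice.rank ℝ L]
    simp
  have h := ZLattice.summable_norm_rpow L (-((m : ℝ) + 2)) (by rw [hrank]; linarith)
  exact h.comp_injective (i := fun k => (⟨latticePoint k, hmem k⟩ : L)) fun k l hkl =>
    latticePoint_injective (Subtype.ext_iff.1 hkl)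

theorem exchange_iUnion_left {ι : Type*} [Countable ι] {A : ι → Set (E m)}
    (hA : ∀ i, MeasurableSet (A i)) (hd : Pairwise (Function.onFun Disjoint A)) (S : Set (E m))
    (t : ℝ) : exchange (⋃ i, A i) S t = ∑' i, exchange (A i) S t :=
  lintegral_iUnion hA hd _

theorem exchange_iUnion_right {ι : Type*} [Countable ι] {A : ι → Set (E m)}
    (hA : ∀ i, MeasurableSet (A i)) (hd : Pairwise (Function.onFun Disjoint A)) (S : Set (E m))
    (t : ℝ) : exchange S (⋃ i, A i) t = ∑' i, exchange S (A i) t := by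
  rw [exchange_swap, exchange_iUnion_left hA hd]
  exact tsum_congr fun i => exchange_swap _ _ _

open Classical in
/-- The heat exchanged between distinct members of a family of sets. -/
def crossExchange {ι : Type*} (A : ι → Set (E m)) (t : ℝ) : ℝ≥0∞ :=
  ∑' i, ∑' j, if j = i then 0 else exchange (A i) (A j) t

theorem heatContent_iUnion {ι : Type*} [Countable ι] {A : ι → Set (E m)}
    (hA : ∀ i, MeasurableSet (A i)) (hd : Pairwise (Function.onFun Disjoint A)) (t : ℝ) :
    heatContent (⋃ i, A i) t = ∑' i, exchange (A i) (A i) t + crossExchange A t := by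
  classical
  rw [heatContent_eq_exchange, exchange_iUnion_left hA hd, crossExchange, ← ENNReal.tsum_add]
  refine tsum_congr fun i => ?_
  rw [exchange_iUnion_right hA hd, ENNReal.tsum_eq_add_tsum_ite i]

/-- Heat leaving one ball may enter another, so summing individual losses overcounts the loss of the
union by the cross exchange. The additive form avoids truncated subtraction. -/
theorem volume_iUnion_add_crossExchange {ι : Type*} [Countable ι] {A : ι → Set (E m)}
    (hA : ∀ i, MeasurableSet (A i)) (hd : Pairwise (Function.onFun Disjoint A)) {t : ℝ}
    (ht : 0 < t) :
    volume (⋃ i, A i) + crossExchange A t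
      = heatContent (⋃ i, A i) t + ∑' i, exchange (A i) (A i)ᶜ t := by
  rw [heatContent_iUnion hA hd, measure_iUnion hd hA, add_right_comm, ← ENNReal.tsum_add]
  congr 1
  exact tsum_congr fun i => (exchange_add_compl _ (hA i) ht).symm

theorem mul_le_sq_add_sq (x y : ℝ≥0∞) : x * y ≤ x ^ 2 + y ^ 2 := by
  rcases le_total x y with h | h
  · calc x * y ≤ y * y := by gcongr
      _ = y ^ 2 := (sq y).symm
      _ ≤ _ := le_add_self
  · calc x * y ≤ x * x := by gcongr
      _ = x ^ 2 := (sq x).symm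
      _ ≤ _ := le_self_add

theorem dist_latticePoint {z : ℕ+ ≃ (Fin m → ℤ)} {i j : ℕ+} (hij : i ≠ j) :
    1 ≤ dist (latticePoint (z i)) (latticePoint (z j)) := by
  rw [dist_eq_norm, latticePoint_sub]
  exact one_le_norm_latticePoint (sub_ne_zero.2 (z.injective.ne hij))

/-- A Schur-type estimate: the kernel between two balls is dominated by `t` times a summable
function of the difference of their centres, and the product of volumes is split into squares. Only
square-summability of the volumes is used, since in the first regime the volumes themselves are not
summable. -/
theorem exists_crossExchange_le (z : ℕ+ ≃ (Fin m → ℤ)) (r : ℕ+ → ℝ) (hr : ∀ i, r i ≤ 1 / 4)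
    (hsum : ∑' i, volume (Metric.ball (latticePoint (z i)) (r i)) ^ 2 < ⊤) :
    ∃ C : ℝ, 0 ≤ C ∧ ∀ t : ℝ, 0 < t →
      crossExchange (fun i => Metric.ball (latticePoint (z i)) (r i)) t ≤ ENNReal.ofReal (C * t) := by
  obtain ⟨C₀, hC₀, hker⟩ := exists_gaussKernel_le m
  set B := fun i => Metric.ball (latticePoint (z i)) (r i) with hB
  set V := ∑' i, volume (B i) ^ 2 with hV
  set W : (Fin m → ℤ) → ℝ≥0∞ := fun k => ENNReal.ofReal (‖latticePoint k‖ ^ (-((m : ℝ) + 2)))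
    with hW
  set S := ∑' k, W k with hS
  have hSfin : S ≠ ⊤ := (summable_norm_latticePoint_rpow m).tsum_ofReal_ne_top
  -- Reindexing by the bijection `z` and then translating shows that row and column sums do not
  -- depend on the enumeration.
  have hWsum : ∀ k, ∑' j, W (k - z j) = S := fun k => by
    rw [z.tsum_eq (fun l => W (k - l))]
    exact (Equiv.subLeft k).tsum_eq W
  have hWsum' : ∀ k, ∑' j, W (z j - k) = S := fun k => by
    rw [z.tsum_eq (fun l => W (l - k))]
    exact (Equiv.subRight k).tsum_eq W
  set K := C₀ * 2 ^ ((m : ℝ) + 2) with hK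
  have hpair : ∀ t : ℝ, 0 < t → ∀ i j, i ≠ j → exchange (B i) (B j) t
      ≤ ENNReal.ofReal (K * t) * (W (z i - z j) * (volume (B i) ^ 2 + volume (B j) ^ 2)) := by
    intro t ht i j hij
    have hd := dist_latticePoint (z := z) hij
    have hle : ∀ x ∈ B i, ∀ y ∈ B j, gaussKernel t (x - y)
        ≤ ENNReal.ofReal (K * t) * W (z i - z j) := by
      intro x hx y hy
      have hx' : dist x (latticePoint (z i)) < r i := hx
      have hy' : dist y (latticePoint (z j)) < r j := hy
      -- The triangle inequality loses at most `1 / 2`, which is at most half of the distance of the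
      -- centres because that distance is at least `1`.
      have hxy : dist (latticePoint (z i)) (latticePoint (z j)) / 2 ≤ dist x y := by
        have := dist_triangle4 (latticePoint (z i)) x y (latticePoint (z j))
        rw [dist_comm (latticePoint (z i)) x] at this
        linarith [hr i, hr j]
      have hne : x - y ≠ 0 := by
        rw [sub_ne_zero, ← dist_pos]
        linarith
      refine (hker t ht _ hne).trans ?_
      rw [hW, ← ENNReal.ofReal_mul (by positivity), ← latticePoint_sub, ← dist_eq_norm,
        ← dist_eq_norm]
      apply ENNReal.ofReal_le_ofReal
      set D := dist (latticePoint (z i)) (latticePoint (z j))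
      have hDpos : 0 < D := by linarith
      have h1 : dist x y ^ (-((m : ℝ) + 2)) ≤ (D / 2) ^ (-((m : ℝ) + 2)) := by
        apply Real.rpow_le_rpow_of_nonpos (by positivity) hxy
        have : (0 : ℝ) ≤ m := Nat.cast_nonneg m
        linarith
      have h2 : (D / 2) ^ (-((m : ℝ) + 2)) = 2 ^ ((m : ℝ) + 2) * D ^ (-((m : ℝ) + 2)) := by
        rw [Real.div_rpow hDpos.le (by norm_num), Real.rpow_neg (by norm_num : (0 : ℝ) ≤ 2)]
        field_simp
      calc C₀ * t * dist x y ^ (-((m : ℝ) + 2))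
          ≤ C₀ * t * (2 ^ ((m : ℝ) + 2) * D ^ (-((m : ℝ) + 2))) := by
            rw [← h2]
            gcongr
        _ = _ := by rw [hK]; ring
    refine (exchange_le_mul _ _ t measurableSet_ball measurableSet_ball hle).trans ?_
    rw [mul_assoc, mul_assoc, mul_comm (volume (B j))]
    gcongr
    exact mul_le_sq_add_sq _ _
  refine ⟨K * (2 * (S * V).toReal), by positivity, fun t ht => ?_⟩
  calc crossExchange B t
      ≤ ∑' i, ∑' j, ENNReal.ofReal (K * t) *
          (W (z i - z j) * (volume (B i) ^ 2 + volume (B j) ^ 2)) := by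
        unfold crossExchange
        refine ENNReal.tsum_le_tsum fun i => ENNReal.tsum_le_tsum fun j => ?_
        split_ifs with h
        · exact zero_le
        · exact hpair t ht i j (Ne.symm h)
    _ = ENNReal.ofReal (K * t) * (∑' i, ∑' j, W (z i - z j) * volume (B i) ^ 2 +
          ∑' i, ∑' j, W (z i - z j) * volume (B j) ^ 2) := by
        simp_rw [ENNReal.tsum_mul_left, mul_add, ENNReal.tsum_add, ← mul_add]
    _ = ENNReal.ofReal (K * t) * (S * V + S * V) := by
        congr 2
        · simp_rw [ENNReal.tsum_mul_right, hWsum, ENNReal.tsum_mul_left, hV]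
        · rw [ENNReal.tsum_comm]
          simp_rw [ENNReal.tsum_mul_right, hWsum', ENNReal.tsum_mul_left, hV]
    _ = ENNReal.ofReal (K * (2 * (S * V).toReal) * t) := by
        rw [← two_mul, ← ENNReal.ofReal_toReal (ENNReal.mul_ne_top hSfin hsum.ne),
          show (2 : ℝ≥0∞) = ENNReal.ofReal 2 by simp, ← ENNReal.ofReal_mul (by norm_num),
          ← ENNReal.ofReal_mul (by positivity), ENNReal.toReal_ofReal ENNReal.toReal_nonneg]
        congr 1
        ring

/-! ### Translation to the origin, radii, volume and perimeter of the union -/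

theorem exchange_translate (A B : Set (E m)) (c : E m) (t : ℝ)
    (hA : MeasurableSet A) (hB : MeasurableSet B) :
    exchange ((fun x => x - c) ⁻¹' A) ((fun x => x - c) ⁻¹' B) t = exchange A B t := by
  have hset : ∀ {T : Set (E m)}, MeasurableSet T → ∀ f : E m → ℝ≥0∞,
      ∫⁻ x in (fun x => x - c) ⁻¹' T, f x = ∫⁻ x in T, f (x + c) := by
    intro T hT f
    rw [← lintegral_indicator (hT.preimage (measurable_sub_const c)),
      ← lintegral_indicator hT, ← lintegral_add_right_eq_self _ c]
    refine lintegral_congr fun x => ?_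
    by_cases hx : x ∈ T
    · rw [Set.indicator_of_mem hx, Set.indicator_of_mem]
      simpa using hx
    · rw [Set.indicator_of_notMem hx, Set.indicator_of_notMem]
      simpa using hx
  unfold exchange
  rw [hset hA]
  simp_rw [hset hB, add_sub_add_right_eq_sub]

theorem preimage_sub_ball (c : E m) (r : ℝ) :
    (fun x => x - c) ⁻¹' Metric.ball 0 r = Metric.ball c r := by
  ext x
  simp [dist_eq_norm]

theorem exchange_ball_self (c : E m) (r t : ℝ) :
    exchange (Metric.ball c r) (Metric.ball c r) t
      = exchange (Metric.ball (0 : E m) r) (Metric.ball 0 r) t := by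
  rw [← preimage_sub_ball, exchange_translate _ _ _ _ measurableSet_ball measurableSet_ball]

theorem exchange_ball_compl (c : E m) (r t : ℝ) :
    exchange (Metric.ball c r) (Metric.ball c r)ᶜ t = ballLoss m r t := by
  rw [← preimage_sub_ball, ← Set.preimage_compl,
    exchange_translate _ _ _ _ measurableSet_ball measurableSet_ball.compl, ballLoss]

/-- The radius function `s ↦ a s^{-α}`. -/
def radius (a α s : ℝ) : ℝ := a * s ^ (-α)

theorem radius_pos {a α s : ℝ} (ha : 0 < a) (hs : 0 < s) : 0 < radius a α s := by
  unfold radius; positivity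

theorem radius_anti {a α : ℝ} (ha : 0 < a) (hα : 0 < α) : AntitoneOn (radius a α) (Set.Ioi 0) := by
  intro s hs u _ hsu
  have hs : 0 < s := hs
  unfold radius
  have := Real.rpow_le_rpow_of_nonpos hs hsu (by linarith : -α ≤ 0)
  gcongr

theorem radius_pow {a α s : ℝ} (hs : 0 < s) (p : ℕ) :
    radius a α s ^ p = a ^ p * s ^ (-(p * α)) := by
  rw [radius, mul_pow, ← Real.rpow_natCast, ← Real.rpow_natCast (s ^ (-α)), ← Real.rpow_mul hs.le]
  congr 2
  ring

theorem radius_one (a α : ℝ) : radius a α 1 = a := by simp [radius]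

theorem pnat_cast_pos (i : ℕ+) : (0 : ℝ) < ((i : ℕ) : ℝ) := by exact_mod_cast i.pos

theorem radius_pnat_le {a α : ℝ} (ha : 0 < a) (hα : 0 < α) (i : ℕ+) :
    radius a α (i : ℕ) ≤ a := by
  have h1 : (1 : ℝ) ≤ ((i : ℕ) : ℝ) := by exact_mod_cast Nat.succ_le_of_lt i.pos
  simpa [radius_one] using radius_anti ha hα (Set.mem_Ioi.2 one_pos)
    (Set.mem_Ioi.2 (pnat_cast_pos i)) h1

theorem tsum_radius_pow_lt_top {a α : ℝ} (c : ℝ) (p : ℕ) (hp : 1 < p * α) :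
    ∑' i : ℕ+, ENNReal.ofReal (c * radius a α (i : ℕ) ^ p) < ⊤ := by
  have h1 : Summable fun n : ℕ => (n : ℝ) ^ (-(p * α)) :=
    Real.summable_nat_rpow.2 (by linarith)
  have h2 : Summable fun i : ℕ+ => c * (a ^ p * ((i : ℕ) : ℝ) ^ (-(p * α))) :=
    ((h1.comp_injective PNat.coe_injective).mul_left _).mul_left _
  simp_rw [radius_pow (pnat_cast_pos _)]
  exact h2.tsum_ofReal_lt_top

/-- No ball corresponds to `s < 1`, but the exactly computable integral runs over all of `(0, ∞)`.
This bounds the added piece, where the radius blows up at `0`. -/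
theorem lintegral_Ioc_radius_pow {a α : ℝ} {p : ℕ} (hp : p * α < 1) (c : ℝ) :
    ∫⁻ s in Set.Ioc (0 : ℝ) 1, ENNReal.ofReal (c * radius a α s ^ p) < ⊤ := by
  have h1 : IntegrableOn (fun s : ℝ => s ^ (-(p * α))) (Set.Ioc 0 1) := by
    have := intervalIntegral.intervalIntegrable_rpow' (a := 0) (b := 1)
      (by linarith : -1 < -((p : ℝ) * α))
    rwa [intervalIntegrable_iff_integrableOn_Ioc_of_le zero_le_one] at this
  have h2 : IntegrableOn (fun s : ℝ => c * (a ^ p * s ^ (-(p * α)))) (Set.Ioc 0 1) :=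
    (h1.const_mul _).const_mul _
  rw [setLIntegral_congr_fun measurableSet_Ioc fun s hs => by rw [radius_pow hs.1]]
  exact h2.lintegral_lt_top

theorem abs_toReal_sub_le {x y : ℝ≥0∞} {D : ℝ} (hD : 0 ≤ D) (hx : x < ⊤) (hy : y < ⊤)
    (h1 : x ≤ ENNReal.ofReal D + y) (h2 : y ≤ ENNReal.ofReal D + x) :
    |x.toReal - y.toReal| ≤ D := by
  have aux : ∀ {u v : ℝ≥0∞}, v < ⊤ → u ≤ ENNReal.ofReal D + v → u.toReal ≤ D + v.toReal := by
    intro u v hv huv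
    have := ENNReal.toReal_mono (ENNReal.add_ne_top.2 ⟨ENNReal.ofReal_ne_top, hv.ne⟩) huv
    rwa [ENNReal.toReal_add ENNReal.ofReal_ne_top hv.ne, ENNReal.toReal_ofReal hD] at this
  rw [abs_le]
  constructor <;> linarith [aux hy h1, aux hx h2]

/-- Comparison of the sum of an antitone function with its integral over the half-line. -/
theorem abs_tsum_sub_lintegral_le {f : ℝ → ℝ≥0∞} (hf : AntitoneOn f (Set.Ioi 0)) {D : ℝ}
    (hD : 0 ≤ D) (h1 : f 1 ≤ ENNReal.ofReal D)
    (h2 : ∫⁻ s in Set.Ioc 0 1, f s ≤ ENNReal.ofReal D)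
    (hfin : ∑' i : ℕ+, f ((i : ℕ) : ℝ) < ⊤) :
    ∫⁻ s in Set.Ioi 0, f s < ⊤ ∧
      |(∑' i : ℕ+, f ((i : ℕ) : ℝ)).toReal - (∫⁻ s in Set.Ioi 0, f s).toReal| ≤ D := by
  have hle : ∫⁻ s in Set.Ioi 0, f s ≤ ENNReal.ofReal D + ∑' i : ℕ+, f ((i : ℕ) : ℝ) := by
    rw [← Set.Ioc_union_Ioi_eq_Ioi (zero_le_one' ℝ)]
    refine (lintegral_union_le _ _ _).trans ?_
    gcongr
    exact lintegral_le_tsum hf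
  have hlt : ∫⁻ s in Set.Ioi 0, f s < ⊤ :=
    hle.trans_lt (ENNReal.add_lt_top.2 ⟨ENNReal.ofReal_lt_top, hfin⟩)
  refine ⟨hlt, abs_toReal_sub_le hD hfin hlt ?_ hle⟩
  refine (tsum_le_lintegral hf).trans ?_
  gcongr
  exact zero_le_one

theorem ballUnion_eq (a α : ℝ) (z : ℕ+ ≃ (Fin m → ℤ)) :
    ballUnion a α z = ⋃ i : ℕ+, Metric.ball (latticePoint (z i)) (radius a α (i : ℕ)) := rfl

theorem pairwise_disjoint_balls {a α : ℝ} (ha : 0 < a) (ha' : a ≤ 1 / 4) (hα : 0 < α)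
    (z : ℕ+ ≃ (Fin m → ℤ)) :
    Pairwise (Function.onFun Disjoint fun i : ℕ+ =>
      Metric.ball (latticePoint (z i)) (radius a α (i : ℕ))) := by
  intro i j hij
  refine Metric.ball_disjoint_ball ?_
  linarith [dist_latticePoint (z := z) hij, radius_pnat_le ha hα i, radius_pnat_le ha hα j]

theorem volume_ball_radius (hm : 0 < m) {a α : ℝ} (ha : 0 < a) (c : E m) {s : ℝ} (hs : 0 < s) :
    volume (Metric.ball c (radius a α s)) = ENNReal.ofReal (unitBallVolume m * radius a α s ^ m) :=
  volume_ball_eq c (radius_pos ha hs).le hm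

theorem tsum_volume_sq_lt_top (hm : 0 < m) {a α : ℝ} (ha : 0 < a) (z : ℕ+ ≃ (Fin m → ℤ))
    (hmα : 1 < 2 * m * α) :
    ∑' i : ℕ+, volume (Metric.ball (latticePoint (z i)) (radius a α (i : ℕ))) ^ 2 < ⊤ := by
  have h := tsum_radius_pow_lt_top (a := a) (α := α) (unitBallVolume m ^ 2) (2 * m)
    (by push_cast; exact hmα)
  refine lt_of_eq_of_lt (tsum_congr fun i => ?_) h
  have h1 := radius_pos (α := α) ha (pnat_cast_pos i)
  have h2 := unitBallVolume_pos m
  rw [volume_ball_radius hm ha _ (pnat_cast_pos i), ← ENNReal.ofReal_pow (by positivity)]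
  congr 1
  ring

theorem volume_ballUnion (hm : 0 < m) {a α : ℝ} (ha : 0 < a) (ha' : a ≤ 1 / 4) (hα : 0 < α)
    (z : ℕ+ ≃ (Fin m → ℤ)) :
    volume (ballUnion a α z)
      = ∑' i : ℕ+, ENNReal.ofReal (unitBallVolume m * radius a α (i : ℕ) ^ m) := by
  rw [ballUnion_eq, measure_iUnion (pairwise_disjoint_balls ha ha' hα z)
    fun i => measurableSet_ball]
  exact tsum_congr fun i => volume_ball_radius hm ha _ (pnat_cast_pos i)

theorem perimeter_ballUnion (hm : 0 < m) {a α : ℝ} (ha : 0 < a) (ha' : a ≤ 1 / 4) (hα : 0 < α)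
    (z : ℕ+ ≃ (Fin m → ℤ)) :
    perimeter (ballUnion a α z)
      = ∑' i : ℕ+, ENNReal.ofReal (unitSphereArea m * radius a α (i : ℕ) ^ (m - 1)) := by
  rw [ballUnion_eq]
  exact le_antisymm
    (perimeter_iUnion_ball_le hm _ _ (fun i => (radius_pos ha (pnat_cast_pos i)).le)
      (pairwise_disjoint_balls ha ha' hα z))
    (le_perimeter_iUnion_ball hm _ _ (fun i => radius_pos ha (pnat_cast_pos i))
      (fun i => (radius_pnat_le ha hα i).trans ha') fun i j => dist_latticePoint)

theorem heatContent_le_volume (Ω : Set (E m)) {t : ℝ} (ht : 0 < t) :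
    heatContent Ω t ≤ volume Ω := exchange_le_volume Ω Ω ht

theorem prefactor_pos (m : ℕ) {a α : ℝ} (ha : 0 < a) (hα : 0 < α) (hmα : 1 < 2 * m * α) :
    0 < prefactor m a α := by
  have : 0 < Real.Gamma ((2 * m * α - 1) / (2 * α)) :=
    Real.Gamma_pos_of_pos (div_pos (by linarith) (by positivity))
  unfold prefactor
  positivity

/-- The integral of the heat content of a ball over the family of radii. -/
theorem lintegral_exchange_ball (hm : 0 < m) {a α t : ℝ} (ha : 0 < a) (hα : 0 < α) (ht : 0 < t)
    (hmα : 1 < 2 * m * α) :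
    ∫⁻ s in Set.Ioi (0 : ℝ), exchange (Metric.ball (0 : E m) (radius a α s))
        (Metric.ball 0 (radius a α s)) t
      = ENNReal.ofReal (prefactor m a α * t ^ ((m * α - 1) / (2 * α))) * innerIntegral m α := by
  rw [innerIntegral, ← lintegral_exchange_dilated hm ha hα ht hmα _ _ measurableSet_ball
    measurableSet_ball]
  refine setLIntegral_congr_fun measurableSet_Ioi fun s hs => ?_
  have e : a * s ^ (-α) = radius a α s := rfl
  rw [e, preimage_smul_ball (radius_pos ha hs)]

/-- The integral of the heat loss of a ball over the family of radii. -/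
theorem lintegral_ballLoss (hm : 0 < m) {a α t : ℝ} (ha : 0 < a) (hα : 0 < α) (ht : 0 < t)
    (hmα : 1 < 2 * m * α) :
    ∫⁻ s in Set.Ioi (0 : ℝ), ballLoss m (radius a α s) t
      = ENNReal.ofReal (prefactor m a α * t ^ ((m * α - 1) / (2 * α))) * outerIntegral m α := by
  rw [outerIntegral, ← lintegral_exchange_dilated hm ha hα ht hmα _ _ measurableSet_ball
    measurableSet_ball.compl]
  refine setLIntegral_congr_fun measurableSet_Ioi fun s hs => ?_
  have e : a * s ^ (-α) = radius a α s := rfl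
  rw [e, Set.preimage_compl, preimage_smul_ball (radius_pos ha hs), ballLoss]

theorem lt_top_of_ofReal_mul_lt_top {c : ℝ} (hc : 0 < c) {x : ℝ≥0∞}
    (h : ENNReal.ofReal c * x < ⊤) : x < ⊤ := by
  rw [lt_top_iff_ne_top]
  rintro rfl
  rw [ENNReal.mul_top (ENNReal.ofReal_pos.2 hc).ne'] at h
  exact lt_irrefl _ h

/-! ### Asymptotics in the five regimes -/

theorem heatContent_asymptotics (hm : 0 < m) {a α : ℝ} (ha : 0 < a) (ha' : a ≤ 1 / 4)
    (z : ℕ+ ≃ (Fin m → ℤ)) (h1 : 1 / (2 * (m : ℝ)) < α) (h2 : α < 1 / (m : ℝ)) :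
    (∀ t : ℝ, 0 < t → heatContent (ballUnion a α z) t < ⊤) ∧ innerIntegral m α < ⊤ ∧
      (fun t : ℝ => (heatContent (ballUnion a α z) t).toReal
          - cConst m a α * t ^ ((m * α - 1) / (2 * α))) =O[𝓝[>] 0] (fun _ : ℝ => (1 : ℝ)) := by
  have hm' : (0 : ℝ) < m := by exact_mod_cast hm
  have hα : 0 < α := lt_trans (by positivity) h1
  have hmα : 1 < 2 * m * α := by
    rw [div_lt_iff₀ (by positivity)] at h1
    linarith
  have hmα' : m * α < 1 := by
    rw [lt_div_iff₀ hm'] at h2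
    linarith
  have hω := unitBallVolume_pos m
  set f : ℝ → ℝ → ℝ≥0∞ := fun t s => exchange (Metric.ball (0 : E m) (radius a α s))
        (Metric.ball 0 (radius a α s)) t with hf
  have hanti : ∀ t, AntitoneOn (f t) (Set.Ioi 0) := fun t s hs u hu hsu =>
    exchange_mono (Metric.ball_subset_ball (radius_anti ha hα hs hu hsu))
      (Metric.ball_subset_ball (radius_anti ha hα hs hu hsu)) t
  obtain ⟨C, hC, hcross⟩ := exists_crossExchange_le z (fun i => radius a α (i : ℕ))
    (fun i => (radius_pnat_le ha hα i).trans ha') (tsum_volume_sq_lt_top hm ha z hmα)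
  have hH : ∀ t, heatContent (ballUnion a α z) t = ∑' i : ℕ+, f t ((i : ℕ) : ℝ) +
      crossExchange (fun i : ℕ+ => Metric.ball (latticePoint (z i)) (radius a α (i : ℕ))) t := by
    intro t
    rw [ballUnion_eq, heatContent_iUnion (fun i => measurableSet_ball)
      (pairwise_disjoint_balls ha ha' hα z)]
    simp_rw [exchange_ball_self, hf]
  have hfin : ∀ t, 0 < t → ∑' i : ℕ+, f t ((i : ℕ) : ℝ) < ⊤ := by
    intro t ht
    -- For fixed `t` the kernel is bounded, so each self-exchange is at most a constant times the
    -- squared volume. The bound by the volume itself would not be summable, since `m * α < 1`.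
    have hle : ∀ i : ℕ+, f t ((i : ℕ) : ℝ) ≤ ENNReal.ofReal ((4 * Real.pi * t) ^ (-(m : ℝ) / 2)) *
        volume (Metric.ball (latticePoint (z i)) (radius a α (i : ℕ))) ^ 2 := by
      intro i
      refine (exchange_le_mul _ _ t measurableSet_ball measurableSet_ball
        fun x _ y _ => gaussKernel_le t ht (x - y)).trans (le_of_eq ?_)
      rw [volume_ball_radius hm ha _ (pnat_cast_pos i),
        volume_ball_radius hm ha _ (pnat_cast_pos i), sq, mul_assoc]
    refine (ENNReal.tsum_le_tsum hle).trans_lt ?_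
    rw [ENNReal.tsum_mul_left]
    exact ENNReal.mul_lt_top ENNReal.ofReal_lt_top (tsum_volume_sq_lt_top hm ha z hmα)
  have hcfin : ∀ t, 0 < t → crossExchange
      (fun i : ℕ+ => Metric.ball (latticePoint (z i)) (radius a α (i : ℕ))) t < ⊤ :=
    fun t ht => (hcross t ht).trans_lt ENNReal.ofReal_lt_top
  have hvol : ∀ t, 0 < t → ∀ s, 0 < s →
      f t s ≤ ENNReal.ofReal (unitBallVolume m * radius a α s ^ m) := fun t ht s hs => by
    rw [← volume_ball_radius hm ha (0 : E m) hs]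
    exact exchange_le_volume _ _ ht
  set J := ∫⁻ s in Set.Ioc (0 : ℝ) 1, ENNReal.ofReal (unitBallVolume m * radius a α s ^ m) with hJ
  have hJfin : J < ⊤ := lintegral_Ioc_radius_pow hmα' _
  set D := unitBallVolume m * a ^ m + J.toReal with hD
  have hD0 : 0 ≤ D := by positivity
  have hcomp : ∀ t, 0 < t → ∫⁻ s in Set.Ioi 0, f t s < ⊤ ∧
      |(∑' i : ℕ+, f t ((i : ℕ) : ℝ)).toReal - (∫⁻ s in Set.Ioi 0, f t s).toReal| ≤ D := by
    intro t ht
    refine abs_tsum_sub_lintegral_le (hanti t) hD0 ?_ ?_ (hfin t ht)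
    · refine (hvol t ht 1 one_pos).trans (ENNReal.ofReal_le_ofReal ?_)
      rw [radius_one, hD]
      linarith [ENNReal.toReal_nonneg (a := J)]
    · calc ∫⁻ s in Set.Ioc 0 1, f t s ≤ J :=
            setLIntegral_mono' measurableSet_Ioc fun s hs => hvol t ht s hs.1
        _ = ENNReal.ofReal J.toReal := (ENNReal.ofReal_toReal hJfin.ne).symm
        _ ≤ _ := ENNReal.ofReal_le_ofReal (le_add_of_nonneg_left (by positivity))
  have hval : ∀ t, 0 < t → ∫⁻ s in Set.Ioi 0, f t s
      = ENNReal.ofReal (prefactor m a α * t ^ ((m * α - 1) / (2 * α))) * innerIntegral m α :=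
    fun t ht => lintegral_exchange_ball hm ha hα ht hmα
  have hpre := prefactor_pos m ha hα hmα
  -- The comparison with a convergent sum makes the integral over the radii finite at `t = 1`, and
  -- that integral is a positive multiple of `innerIntegral`.
  have hinner : innerIntegral m α < ⊤ := by
    have h := (hcomp 1 one_pos).1
    rw [hval 1 one_pos] at h
    exact lt_top_of_ofReal_mul_lt_top (by positivity) h
  refine ⟨fun t ht => by
    rw [hH]; exact ENNReal.add_lt_top.2 ⟨hfin t ht, hcfin t ht⟩, hinner, ?_⟩
  refine IsBigO.of_bound (D + C) ?_
  filter_upwards [Ioo_mem_nhdsGT (zero_lt_one' ℝ)] with t ht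
  have h3 := (hcomp t ht.1).2
  rw [hval t ht.1, ENNReal.toReal_mul, ENNReal.toReal_ofReal (by have := ht.1; positivity)] at h3
  have h4 : (crossExchange (fun i : ℕ+ =>
      Metric.ball (latticePoint (z i)) (radius a α (i : ℕ))) t).toReal ≤ C := by
    refine ENNReal.toReal_le_of_le_ofReal hC ((hcross t ht.1).trans (ENNReal.ofReal_le_ofReal ?_))
    nlinarith [ht.1, ht.2]
  rw [hH, ENNReal.toReal_add (hfin t ht.1).ne (hcfin t ht.1).ne, cConst, norm_one, mul_one,
    Real.norm_eq_abs]
  set X := (∑' i : ℕ+, f t ((i : ℕ) : ℝ)).toReal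
  rw [abs_le] at h3 ⊢
  have h5 := ENNReal.toReal_nonneg (a := crossExchange (fun i : ℕ+ =>
      Metric.ball (latticePoint (z i)) (radius a α (i : ℕ))) t)
  constructor <;> nlinarith [h3.1, h3.2]

/-- The heat loss is the sum of the heat losses of the balls, up to `O(t)`. -/
theorem exists_heatLoss_sub_tsum_le (hm : 0 < m) {a α : ℝ} (ha : 0 < a) (ha' : a ≤ 1 / 4)
    (z : ℕ+ ≃ (Fin m → ℤ)) (hα : 0 < α) (hmα : 1 < m * α) :
    volume (ballUnion a α z) < ⊤ ∧
    (∀ t : ℝ, 0 < t → heatContent (ballUnion a α z) t < ⊤) ∧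
    (∀ t : ℝ, 0 < t → ∑' i : ℕ+, ballLoss m (radius a α (i : ℕ)) t < ⊤) ∧
    ∃ C : ℝ, 0 ≤ C ∧ ∀ t : ℝ, 0 < t → |heatLoss (ballUnion a α z) t
      - (∑' i : ℕ+, ballLoss m (radius a α (i : ℕ)) t).toReal| ≤ C * t := by
  have hvol : volume (ballUnion a α z) < ⊤ := by
    rw [volume_ballUnion hm ha ha' hα]
    exact tsum_radius_pow_lt_top _ _ hmα
  have hH : ∀ t : ℝ, 0 < t → heatContent (ballUnion a α z) t < ⊤ := fun t ht =>
    (heatContent_le_volume _ ht).trans_lt hvol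
  have hF : ∀ t : ℝ, 0 < t → ∑' i : ℕ+, ballLoss m (radius a α (i : ℕ)) t < ⊤ := by
    intro t ht
    rw [volume_ballUnion hm ha ha' hα] at hvol
    refine lt_of_le_of_lt (ENNReal.tsum_le_tsum fun i => ?_) hvol
    rw [← volume_ball_radius hm ha (0 : E m) (pnat_cast_pos i)]
    exact exchange_le_volume _ _ ht
  obtain ⟨C, hC, hcross⟩ := exists_crossExchange_le z (fun i => radius a α (i : ℕ))
    (fun i => (radius_pnat_le ha hα i).trans ha')
    (tsum_volume_sq_lt_top hm ha z (by linarith))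
  refine ⟨hvol, hH, hF, C, hC, fun t ht => ?_⟩
  have hbal := volume_iUnion_add_crossExchange
    (A := fun i : ℕ+ => Metric.ball (latticePoint (z i)) (radius a α (i : ℕ)))
    (fun i => measurableSet_ball) (pairwise_disjoint_balls ha ha' hα z) ht
  simp_rw [exchange_ball_compl, ← ballUnion_eq] at hbal
  have hc := hcross t ht
  set X := crossExchange
    (fun i : ℕ+ => Metric.ball (latticePoint (z i)) (radius a α (i : ℕ))) t
  have hXfin : X < ⊤ := hc.trans_lt ENNReal.ofReal_lt_top
  have hbal' := congrArg ENNReal.toReal hbal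
  rw [ENNReal.toReal_add hvol.ne hXfin.ne, ENNReal.toReal_add (hH t ht).ne (hF t ht).ne] at hbal'
  have hX : X.toReal ≤ C * t := ENNReal.toReal_le_of_le_ofReal (by positivity) hc
  have hX0 : 0 ≤ X.toReal := ENNReal.toReal_nonneg
  rw [heatLoss, abs_le]
  constructor <;> linarith

/-- The sum-integral comparison is applied to the losses of the balls. Their surface bound has a
factor `t ^ (1 / 2)`, and its radius power is integrable at `s = 0` because `(m - 1) * α < 1`; this
fixes the error. The cross exchange `O(t)` is smaller. -/
theorem heatLoss_asymptotics_of_infinite_perimeter (hm : 2 ≤ m) {a α : ℝ} (ha : 0 < a)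
    (ha' : a ≤ 1 / 4) (z : ℕ+ ≃ (Fin m → ℤ)) (h1 : 1 / (m : ℝ) < α)
    (h2 : α < 1 / ((m : ℝ) - 1)) :
    volume (ballUnion a α z) < ⊤ ∧ (∀ t : ℝ, 0 < t → heatContent (ballUnion a α z) t < ⊤) ∧
      outerIntegral m α < ⊤ ∧
      (fun t : ℝ => heatLoss (ballUnion a α z) t - dConst m a α * t ^ ((m * α - 1) / (2 * α)))
        =O[𝓝[>] 0] (fun t : ℝ => t ^ (1 / 2 : ℝ)) := by
  obtain ⟨n, rfl⟩ : ∃ n, m = n + 1 := ⟨m - 1, by omega⟩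
  have hn : 0 < n := by omega
  have hn' : (0 : ℝ) < n := by exact_mod_cast hn
  have hα : 0 < α := lt_trans (by positivity) h1
  have hmα : 1 < ((n + 1 : ℕ) : ℝ) * α := by
    rw [div_lt_iff₀ (by positivity)] at h1
    linarith
  have hmα' : n * α < 1 := by
    rw [show ((n + 1 : ℕ) : ℝ) - 1 = n by push_cast; ring, lt_div_iff₀ hn'] at h2
    linarith
  have h2mα : 1 < 2 * ((n + 1 : ℕ) : ℝ) * α := by linarith
  obtain ⟨hvol, hH, hF, C, hC, hloss⟩ :=
    exists_heatLoss_sub_tsum_le n.succ_pos ha ha' z hα hmα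
  set P := Real.pi ^ (-(1 / 2) : ℝ) * unitSphereArea (n + 1) with hP
  have hPpos : 0 < P := by
    have := unitBallVolume_pos (n + 1)
    rw [hP, unitSphereArea]
    positivity
  set J := ∫⁻ s in Set.Ioc (0 : ℝ) 1, ENNReal.ofReal (P * radius a α s ^ n) with hJ
  have hJfin : J < ⊤ := lintegral_Ioc_radius_pow hmα' _
  set D := P * a ^ n + J.toReal with hD
  have hD0 : 0 ≤ D := by positivity
  have hanti : ∀ t, AntitoneOn (fun s => ballLoss (n + 1) (radius a α s) t) (Set.Ioi 0) :=
    fun t s hs u hu hsu =>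
      ballLoss_mono (radius_pos ha hu).le (radius_anti ha hα hs hu hsu) t
  have hbd : ∀ t, 0 < t → ∀ s, 0 < s → ballLoss (n + 1) (radius a α s) t
      ≤ ENNReal.ofReal (P * radius a α s ^ n) * ENNReal.ofReal (t ^ (1 / 2 : ℝ)) := by
    intro t ht s hs
    have := radius_pos (α := α) ha hs
    rw [← ENNReal.ofReal_mul (by positivity)]
    exact ballLoss_le hn this.le ht
  have hcomp := fun (t : ℝ) (ht : 0 < t) =>
    abs_tsum_sub_lintegral_le (hanti t) (D := D * t ^ (1 / 2 : ℝ)) (by positivity)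
      (by
        refine (hbd t ht 1 one_pos).trans ?_
        rw [radius_one, ← ENNReal.ofReal_mul (by positivity)]
        apply ENNReal.ofReal_le_ofReal
        gcongr
        rw [hD]
        linarith [ENNReal.toReal_nonneg (a := J)])
      (by
        calc ∫⁻ s in Set.Ioc 0 1, ballLoss (n + 1) (radius a α s) t
            ≤ ∫⁻ s in Set.Ioc (0 : ℝ) 1, ENNReal.ofReal (P * radius a α s ^ n) *
                ENNReal.ofReal (t ^ (1 / 2 : ℝ)) :=
              setLIntegral_mono' measurableSet_Ioc fun s hs => hbd t ht s hs.1
          _ = ENNReal.ofReal (J.toReal * t ^ (1 / 2 : ℝ)) := by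
              rw [lintegral_mul_const' _ _ ENNReal.ofReal_ne_top, ← hJ,
                ENNReal.ofReal_mul ENNReal.toReal_nonneg, ENNReal.ofReal_toReal hJfin.ne]
          _ ≤ _ := by
              apply ENNReal.ofReal_le_ofReal
              gcongr
              rw [hD]
              linarith [show 0 ≤ P * a ^ n by positivity])
      (hF t ht)
  have hval := fun (t : ℝ) (ht : 0 < t) => lintegral_ballLoss (m := n + 1) (t := t) n.succ_pos ha hα ht h2mα
  have hpre := prefactor_pos (n + 1) ha hα h2mα
  have houter : outerIntegral (n + 1) α < ⊤ := by
    have h := (hcomp 1 one_pos).1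
    rw [hval 1 one_pos] at h
    exact lt_top_of_ofReal_mul_lt_top (by positivity) h
  refine ⟨hvol, hH, houter, IsBigO.of_bound (D + C) ?_⟩
  filter_upwards [Ioo_mem_nhdsGT (zero_lt_one' ℝ)] with t ht
  have ht0 := ht.1
  have h3 := (hcomp t ht.1).2
  rw [hval t ht.1, ENNReal.toReal_mul, ENNReal.toReal_ofReal (by positivity)] at h3
  have h4 := hloss t ht.1
  have h5 : t ≤ t ^ (1 / 2 : ℝ) := by
    nth_rewrite 1 [← Real.rpow_one t]
    exact Real.rpow_le_rpow_of_exponent_ge ht.1 ht.2.le (by norm_num)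
  rw [dConst, Real.norm_eq_abs, Real.norm_of_nonneg (by positivity)]
  have h6 : C * t ≤ C * t ^ (1 / 2 : ℝ) := by gcongr
  set X := (∑' i : ℕ+, ballLoss (n + 1) (radius a α (i : ℕ)) t).toReal
  rw [abs_le] at h3 h4 ⊢
  constructor <;> nlinarith [h3.1, h3.2, h4.1, h4.2]

/-- The sum governing the error in the expansion of the heat loss. -/
def errorSum (m : ℕ) (a α t : ℝ) : ℝ≥0∞ :=
  ∑' i : ℕ+, ENNReal.ofReal (min (radius a α (i : ℕ) ^ (m - 1) * t ^ (1 / 2 : ℝ))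
    (radius a α (i : ℕ) ^ (m - 2) * t))

/-- Summing the two-sided bounds for single balls reproduces the perimeter exactly, so the
finite-perimeter regimes differ only in the size of `errorSum`, which enters here through an
arbitrary upper bound `b`. -/
theorem exists_heatLoss_sub_perimeter_le (hm : 2 ≤ m) {a α : ℝ} (ha : 0 < a) (ha' : a ≤ 1 / 4)
    (z : ℕ+ ≃ (Fin m → ℤ)) (h1 : 1 / ((m : ℝ) - 1) < α) :
    volume (ballUnion a α z) < ⊤ ∧ (∀ t : ℝ, 0 < t → heatContent (ballUnion a α z) t < ⊤) ∧
    perimeter (ballUnion a α z) < ⊤ ∧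
    ∃ C : ℝ, 0 ≤ C ∧ ∀ t b : ℝ, 0 < t → 0 ≤ b → errorSum m a α t ≤ ENNReal.ofReal b →
      |heatLoss (ballUnion a α z) t
        - Real.pi ^ (-(1 / 2) : ℝ) * (perimeter (ballUnion a α z)).toReal * t ^ (1 / 2 : ℝ)|
        ≤ C * (b + t) := by
  obtain ⟨k, rfl⟩ : ∃ k, m = k + 2 := ⟨m - 2, by omega⟩
  have hk : (0 : ℝ) ≤ k := Nat.cast_nonneg k
  rw [show ((k + 2 : ℕ) : ℝ) - 1 = k + 1 by push_cast; ring] at h1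
  have hα : 0 < α := lt_trans (by positivity) h1
  have hkα : 1 < ((k + 1 : ℕ) : ℝ) * α := by
    rw [div_lt_iff₀ (by positivity)] at h1
    push_cast
    linarith
  have hmα : 1 < ((k + 2 : ℕ) : ℝ) * α := by
    push_cast at hkα ⊢
    linarith
  obtain ⟨hvol, hH, hF, C₁, hC₁, hloss⟩ :=
    exists_heatLoss_sub_tsum_le (k + 1).succ_pos ha ha' z hα hmα
  obtain ⟨C₂, hC₂, herr⟩ := exists_le_ballLoss_add k
  have hper := perimeter_ballUnion (k + 1).succ_pos ha ha' hα z
  have hperfin : perimeter (ballUnion a α z) < ⊤ := by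
    rw [hper]
    exact tsum_radius_pow_lt_top _ _ hkα
  refine ⟨hvol, hH, hperfin, C₁ + C₂, by positivity, fun t b ht hb hE => ?_⟩
  set Q := Real.pi ^ (-(1 / 2) : ℝ) * t ^ (1 / 2 : ℝ) with hQ
  have hQpos : 0 < Q := by positivity
  have hσ : 0 < unitSphereArea (k + 2) := by
    have := unitBallVolume_pos (k + 2)
    unfold unitSphereArea
    positivity
  have hterm : ∀ i : ℕ+, ENNReal.ofReal (Real.pi ^ (-(1 / 2) : ℝ) * unitSphereArea (k + 2)
      * radius a α (i : ℕ) ^ (k + 1) * t ^ (1 / 2 : ℝ)) = ENNReal.ofReal Q *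
        ENNReal.ofReal (unitSphereArea (k + 2) * radius a α (i : ℕ) ^ (k + 1)) := fun i => by
    rw [← ENNReal.ofReal_mul hQpos.le, hQ]
    congr 1
    ring
  have hsum : ENNReal.ofReal Q * perimeter (ballUnion a α z)
      = ∑' i : ℕ+, ENNReal.ofReal (Real.pi ^ (-(1 / 2) : ℝ) * unitSphereArea (k + 2)
        * radius a α (i : ℕ) ^ (k + 1) * t ^ (1 / 2 : ℝ)) := by
    simp_rw [hterm, ENNReal.tsum_mul_left, hper]
    rfl
  have hup : ∑' i : ℕ+, ballLoss (k + 2) (radius a α (i : ℕ)) t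
      ≤ ENNReal.ofReal Q * perimeter (ballUnion a α z) := by
    rw [hsum]
    exact ENNReal.tsum_le_tsum fun i =>
      ballLoss_le k.succ_pos (radius_pos ha (pnat_cast_pos i)).le ht
  have hlow : ENNReal.ofReal Q * perimeter (ballUnion a α z)
      ≤ ENNReal.ofReal (C₂ * b) + ∑' i : ℕ+, ballLoss (k + 2) (radius a α (i : ℕ)) t := by
    rw [hsum]
    calc _ ≤ ∑' i : ℕ+, (ballLoss (k + 2) (radius a α (i : ℕ)) t + ENNReal.ofReal (C₂ *
            min (radius a α (i : ℕ) ^ (k + 1) * t ^ (1 / 2 : ℝ)) (radius a α (i : ℕ) ^ k * t))) :=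
          ENNReal.tsum_le_tsum fun i => herr _ t (radius_pos ha (pnat_cast_pos i)).le ht
      _ = ∑' i : ℕ+, ballLoss (k + 2) (radius a α (i : ℕ)) t
            + ENNReal.ofReal C₂ * errorSum (k + 2) a α t := by
          simp_rw [ENNReal.ofReal_mul hC₂.le, ENNReal.tsum_add, ENNReal.tsum_mul_left]
          rfl
      _ ≤ _ := by
          rw [add_comm, ENNReal.ofReal_mul hC₂.le]
          gcongr
  have h3 := abs_toReal_sub_le (D := C₂ * b) (by positivity) (hF t ht)
    (ENNReal.mul_lt_top ENNReal.ofReal_lt_top hperfin) (hup.trans le_add_self) hlow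
  rw [ENNReal.toReal_mul, ENNReal.toReal_ofReal hQpos.le] at h3
  have h4 := hloss t ht
  set X := (∑' i : ℕ+, ballLoss (k + 2) (radius a α (i : ℕ)) t).toReal
  rw [show Real.pi ^ (-(1 / 2) : ℝ) * (perimeter (ballUnion a α z)).toReal * t ^ (1 / 2 : ℝ)
    = Q * (perimeter (ballUnion a α z)).toReal by rw [hQ]; ring]
  have h5 : 0 ≤ C₁ * b := by positivity
  have h6 : 0 ≤ C₂ * t := by positivity
  rw [abs_le] at h3 h4 ⊢
  constructor <;> nlinarith [h3.1, h3.2, h4.1, h4.2]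

/-- A bound for the error sum by splitting the half-line at `t^{-1/(2α)}`. -/
theorem errorSum_le (hm : 2 ≤ m) {a α : ℝ} (ha : 0 < a) (ha' : a ≤ 1) (hα : 0 < α)
    (h1 : 1 < ((m : ℝ) - 1) * α) {t : ℝ} (ht : 0 < t) (ht1 : t < 1) :
    errorSum m a α t ≤ ENNReal.ofReal t
      + ENNReal.ofReal t * (∫⁻ s in Set.Ioc 1 (t ^ (-(1 / (2 * α)))),
          ENNReal.ofReal (s ^ (-(((m : ℝ) - 2) * α))))
      + ENNReal.ofReal ((((m : ℝ) - 1) * α - 1)⁻¹ * t ^ ((m * α - 1) / (2 * α))) := by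
  obtain ⟨k, rfl⟩ : ∃ k, m = k + 2 := ⟨m - 2, by omega⟩
  have e1 : ((k + 2 : ℕ) : ℝ) - 1 = (k + 1 : ℕ) := by push_cast; ring
  have e2 : ((k + 2 : ℕ) : ℝ) - 2 = k := by push_cast; ring
  rw [e1] at h1
  rw [e1, e2]
  -- At `s = T` the power `s ^ (-α)` equals `t ^ (1 / 2)`, so up to the factor `a` the two entries
  -- of the minimum balance. The entry with `t` is used before `T`, the one with `t ^ (1 / 2)` after
  -- it.
  set T := t ^ (-(1 / (2 * α))) with hT
  have hT1 : 1 ≤ T := Real.one_le_rpow_of_pos_of_le_one_of_nonpos ht ht1.le (by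
    have : 0 < 1 / (2 * α) := by positivity
    linarith)
  set g : ℝ → ℝ≥0∞ := fun s => ENNReal.ofReal (min (radius a α s ^ (k + 1) * t ^ (1 / 2 : ℝ))
    (radius a α s ^ k * t)) with hg
  have hanti : AntitoneOn g (Set.Ioi 0) := by
    intro s hs u hu hsu
    have h := radius_anti ha hα hs hu hsu
    have hu' := (radius_pos (α := α) ha hu).le
    simp only [hg]
    gcongr
  have hrad : ∀ s, 0 < s → ∀ p : ℕ, radius a α s ^ p ≤ s ^ (-(p * α)) := by
    intro s hs p
    rw [radius_pow hs]
    exact mul_le_of_le_one_left (by positivity) (pow_le_one₀ ha.le ha')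
  have hg1 : g 1 ≤ ENNReal.ofReal t := by
    apply ENNReal.ofReal_le_ofReal
    refine (min_le_right _ _).trans ?_
    rw [radius_one]
    exact mul_le_of_le_one_left ht.le (pow_le_one₀ ha.le ha')
  have hI1 : ∫⁻ s in Set.Ioc 1 T, g s ≤ ENNReal.ofReal t *
      ∫⁻ s in Set.Ioc 1 T, ENNReal.ofReal (s ^ (-((k : ℝ) * α))) := by
    rw [← lintegral_const_mul' _ _ ENNReal.ofReal_ne_top]
    refine setLIntegral_mono' measurableSet_Ioc fun s hs => ?_
    rw [← ENNReal.ofReal_mul ht.le]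
    apply ENNReal.ofReal_le_ofReal
    refine (min_le_right _ _).trans ?_
    rw [mul_comm]
    have := hrad s (by linarith [hs.1]) k
    gcongr
  have hI2 : ∫⁻ s in Set.Ioi T, g s ≤ ENNReal.ofReal ((((k + 1 : ℕ) : ℝ) * α - 1)⁻¹ *
      t ^ ((((k + 2 : ℕ) : ℝ) * α - 1) / (2 * α))) := by
    set β := ((k + 1 : ℕ) : ℝ) * α with hβ
    have hTpos : 0 < T := by linarith
    have hint := integrableOn_Ioi_rpow_of_lt (by linarith : -β < -1) hTpos
    calc ∫⁻ s in Set.Ioi T, g s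
        ≤ ∫⁻ s in Set.Ioi T, ENNReal.ofReal (t ^ (1 / 2 : ℝ)) * ENNReal.ofReal (s ^ (-β)) := by
          refine setLIntegral_mono' measurableSet_Ioi fun s hs => ?_
          have hs0 : 0 < s := hTpos.trans hs
          rw [← ENNReal.ofReal_mul (by positivity)]
          apply ENNReal.ofReal_le_ofReal
          refine (min_le_left _ _).trans ?_
          rw [mul_comm]
          have := hrad s hs0 (k + 1)
          gcongr
      _ = ENNReal.ofReal (t ^ (1 / 2 : ℝ) * (-T ^ (-β + 1) / (-β + 1))) := by
          rw [lintegral_const_mul' _ _ ENNReal.ofReal_ne_top,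
            ← ofReal_integral_eq_lintegral_ofReal hint
              ((ae_restrict_mem measurableSet_Ioi).mono fun s hs =>
                Real.rpow_nonneg (hTpos.trans hs).le _),
            integral_Ioi_rpow_of_lt (by linarith) hTpos, ← ENNReal.ofReal_mul (by positivity)]
      _ ≤ _ := by
          apply ENNReal.ofReal_le_ofReal
          apply le_of_eq
          have e3 : t ^ (1 / 2 : ℝ) * T ^ (-β + 1)
              = t ^ ((((k + 2 : ℕ) : ℝ) * α - 1) / (2 * α)) := by
            rw [hT, ← Real.rpow_mul ht.le, ← Real.rpow_add ht]
            congr 1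
            rw [hβ]
            push_cast
            field_simp
            ring
          rw [← e3]
          have : β - 1 ≠ 0 := by linarith
          have : -β + 1 ≠ 0 := by linarith
          field_simp
          ring
  calc errorSum (k + 2) a α t ≤ g 1 + ∫⁻ s in Set.Ioi 1, g s := tsum_le_lintegral hanti
    _ ≤ ENNReal.ofReal t + ((∫⁻ s in Set.Ioc 1 T, g s) + ∫⁻ s in Set.Ioi T, g s) := by
        rw [← Set.Ioc_union_Ioi_eq_Ioi hT1]
        exact add_le_add hg1 (lintegral_union_le _ _ _)
    _ ≤ _ := by
        rw [add_assoc]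
        exact add_le_add le_rfl (add_le_add hI1 hI2)

theorem lintegral_Ioc_one_rpow_le {q T : ℝ} (hq : q < 1) (hT : 1 ≤ T) :
    ∫⁻ s in Set.Ioc 1 T, ENNReal.ofReal (s ^ (-q)) ≤ ENNReal.ofReal ((1 - q)⁻¹ * T ^ (1 - q)) := by
  have hint : IntegrableOn (fun s : ℝ => s ^ (-q)) (Set.Ioc 1 T) := by
    have := intervalIntegral.intervalIntegrable_rpow' (a := 1) (b := T) (by linarith : -1 < -q)
    rwa [intervalIntegrable_iff_integrableOn_Ioc_of_le hT] at this
  rw [← ofReal_integral_eq_lintegral_ofReal hint ((ae_restrict_mem measurableSet_Ioc).mono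
      fun s hs => Real.rpow_nonneg (by linarith [hs.1]) _),
    ← intervalIntegral.integral_of_le hT, integral_rpow (Or.inl (by linarith))]
  apply ENNReal.ofReal_le_ofReal
  have : 0 < 1 - q := by linarith
  rw [Real.one_rpow, show -q + 1 = 1 - q by ring, div_eq_inv_mul]
  gcongr
  linarith

theorem lintegral_Ioc_one_inv {T : ℝ} (hT : 1 ≤ T) :
    ∫⁻ s in Set.Ioc 1 T, ENNReal.ofReal (s ^ (-1 : ℝ)) = ENNReal.ofReal (Real.log T) := by
  have hcongr : ∀ s ∈ Set.Ioc 1 T, ENNReal.ofReal (s ^ (-1 : ℝ)) = ENNReal.ofReal s⁻¹ :=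
    fun s _ => by rw [Real.rpow_neg_one]
  have hint : IntegrableOn (fun s : ℝ => s⁻¹) (Set.Ioc 1 T) := by
    have : IntervalIntegrable (fun s : ℝ => s⁻¹) volume 1 T :=
      intervalIntegral.intervalIntegrable_inv (fun s hs => by
        rw [Set.uIcc_of_le hT] at hs
        linarith [hs.1]) continuousOn_id
    rwa [intervalIntegrable_iff_integrableOn_Ioc_of_le hT] at this
  rw [setLIntegral_congr_fun measurableSet_Ioc hcongr,
    ← ofReal_integral_eq_lintegral_ofReal hint ((ae_restrict_mem measurableSet_Ioc).mono
      fun s hs => inv_nonneg.2 (by linarith [hs.1])),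
    ← intervalIntegral.integral_of_le hT, integral_inv_of_pos one_pos (by linarith), div_one]

/-- For `(m - 2) * α < 1` the integral up to the splitting point grows like a power, and multiplied
by `t` it has the same exponent as the tail. The product form of the hypothesis also covers `m = 2`,
where `1 / (m - 2)` would be a division by zero. -/
theorem heatLoss_asymptotics_of_slow_decay (hm : 2 ≤ m) {a α : ℝ} (ha : 0 < a) (ha' : a ≤ 1 / 4)
    (z : ℕ+ ≃ (Fin m → ℤ)) (h1 : 1 / ((m : ℝ) - 1) < α) (h2 : ((m : ℝ) - 2) * α < 1) :
    volume (ballUnion a α z) < ⊤ ∧ (∀ t : ℝ, 0 < t → heatContent (ballUnion a α z) t < ⊤) ∧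
      perimeter (ballUnion a α z) < ⊤ ∧
      (fun t : ℝ => heatLoss (ballUnion a α z) t
          - Real.pi ^ (-(1 / 2) : ℝ) * (perimeter (ballUnion a α z)).toReal * t ^ (1 / 2 : ℝ))
        =O[𝓝[>] 0] (fun t : ℝ => t ^ ((m * α - 1) / (2 * α))) := by
  have hm1 : (0 : ℝ) < (m : ℝ) - 1 := by
    have : (2 : ℝ) ≤ m := by exact_mod_cast hm
    linarith
  have hα : 0 < α := lt_trans (by positivity) h1
  have hmα : 1 < ((m : ℝ) - 1) * α := by
    rwa [div_lt_iff₀ hm1, mul_comm] at h1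
  obtain ⟨hvol, hH, hper, C, hC, hmain⟩ := exists_heatLoss_sub_perimeter_le hm ha ha' z h1
  set q := ((m : ℝ) - 2) * α with hq
  set K := 1 + (1 - q)⁻¹ + (((m : ℝ) - 1) * α - 1)⁻¹ with hK
  have hq' : 0 < 1 - q := by linarith
  have hβ' : 0 < ((m : ℝ) - 1) * α - 1 := by linarith
  have hKpos : 0 < K := by positivity
  refine ⟨hvol, hH, hper, IsBigO.of_bound (C * (K + 1)) ?_⟩
  filter_upwards [Ioo_mem_nhdsGT (zero_lt_one' ℝ)] with t ht
  have ht0 := ht.1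
  set R := t ^ ((m * α - 1) / (2 * α)) with hR
  have hRpos : 0 < R := by positivity
  -- The exponent `(m * α - 1) / (2 * α)` is at most `1` precisely because `(m - 2) * α ≤ 1`, so the
  -- `O(t)` contributions are absorbed.
  have htR : t ≤ R := by
    nth_rewrite 1 [← Real.rpow_one t]
    apply Real.rpow_le_rpow_of_exponent_ge ht.1 ht.2.le
    rw [div_le_one (by positivity)]
    linarith
  have hT1 : 1 ≤ t ^ (-(1 / (2 * α))) :=
    Real.one_le_rpow_of_pos_of_le_one_of_nonpos ht0 ht.2.le (by
      have : 0 < 1 / (2 * α) := by positivity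
      linarith)
  have hE : errorSum m a α t ≤ ENNReal.ofReal (K * R) := by
    refine (errorSum_le hm ha (by linarith) hα hmα ht0 ht.2).trans ?_
    calc _ ≤ ENNReal.ofReal t + ENNReal.ofReal t *
            ENNReal.ofReal ((1 - q)⁻¹ * (t ^ (-(1 / (2 * α)))) ^ (1 - q))
          + ENNReal.ofReal ((((m : ℝ) - 1) * α - 1)⁻¹ * R) := by
          gcongr
          exact lintegral_Ioc_one_rpow_le h2 hT1
      _ = ENNReal.ofReal (t + (1 - q)⁻¹ * R + (((m : ℝ) - 1) * α - 1)⁻¹ * R) := by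
          have e : t * ((1 - q)⁻¹ * (t ^ (-(1 / (2 * α)))) ^ (1 - q)) = (1 - q)⁻¹ * R := by
            have : t * (t ^ (-(1 / (2 * α)))) ^ (1 - q) = R := by
              rw [← Real.rpow_mul ht0.le]
              nth_rewrite 1 [← Real.rpow_one t]
              rw [← Real.rpow_add ht0, hR]
              congr 1
              rw [hq]
              field_simp
              ring
            rw [mul_left_comm, this]
          rw [← ENNReal.ofReal_mul ht0.le, e, ENNReal.ofReal_add (by positivity) (by positivity),
            ENNReal.ofReal_add (by positivity) (by positivity)]
      _ ≤ _ := by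
          apply ENNReal.ofReal_le_ofReal
          rw [hK]
          linarith
  have h3 := hmain t (K * R) ht0 (by positivity) hE
  rw [Real.norm_eq_abs, Real.norm_of_nonneg hRpos.le]
  calc _ ≤ C * (K * R + t) := h3
    _ ≤ C * (K * R + R) := by gcongr
    _ = _ := by ring

/-- At `(m - 2) * α = 1` the integrand up to the splitting point is `s⁻¹`, which produces the
logarithm, while the tail exponent becomes exactly `1`. -/
theorem heatLoss_asymptotics_of_critical_decay (hm : 2 < m) {a α : ℝ} (ha : 0 < a)
    (ha' : a ≤ 1 / 4) (z : ℕ+ ≃ (Fin m → ℤ)) (h2 : α = 1 / ((m : ℝ) - 2)) :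
    volume (ballUnion a α z) < ⊤ ∧ (∀ t : ℝ, 0 < t → heatContent (ballUnion a α z) t < ⊤) ∧
      perimeter (ballUnion a α z) < ⊤ ∧
      (fun t : ℝ => heatLoss (ballUnion a α z) t
          - Real.pi ^ (-(1 / 2) : ℝ) * (perimeter (ballUnion a α z)).toReal * t ^ (1 / 2 : ℝ))
        =O[𝓝[>] 0] (fun t : ℝ => t * Real.log (1 / t)) := by
  have hm2 : (0 : ℝ) < (m : ℝ) - 2 := by
    have : (2 : ℝ) < m := by exact_mod_cast hm
    linarith
  have hα : 0 < α := by rw [h2]; positivity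
  have hq : ((m : ℝ) - 2) * α = 1 := by rw [h2]; field_simp
  have hmα : 1 < ((m : ℝ) - 1) * α := by linarith
  have h1 : 1 / ((m : ℝ) - 1) < α := by
    rwa [div_lt_iff₀ (by linarith), mul_comm]
  obtain ⟨hvol, hH, hper, C, hC, hmain⟩ := exists_heatLoss_sub_perimeter_le hm.le ha ha' z h1
  set K := 1 + 1 / (2 * α) + (((m : ℝ) - 1) * α - 1)⁻¹ with hK
  have hβ' : 0 < ((m : ℝ) - 1) * α - 1 := by linarith
  have hKpos : 0 < K := by positivity
  refine ⟨hvol, hH, hper, IsBigO.of_bound (C * (K + 1)) ?_⟩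
  -- Below `exp (-1)` one has `log (1 / t) ≥ 1`, so every term of order `t` is dominated by `t * log
  -- (1 / t)`.
  filter_upwards [Ioo_mem_nhdsGT (Real.exp_pos (-1))] with t ht
  have ht0 := ht.1
  have ht1 : t < 1 := ht.2.trans (by rw [Real.exp_lt_one_iff]; norm_num)
  have hlog : 1 ≤ Real.log (1 / t) := by
    rw [one_div, Real.log_inv]
    have := (Real.log_lt_iff_lt_exp ht0).2 ht.2
    linarith
  set R := t * Real.log (1 / t) with hR
  have htR : t ≤ R := le_mul_of_one_le_right ht0.le hlog
  have hRpos : 0 < R := ht0.trans_le htR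
  have hT1 : 1 ≤ t ^ (-(1 / (2 * α))) :=
    Real.one_le_rpow_of_pos_of_le_one_of_nonpos ht0 ht1.le (by
      have : 0 < 1 / (2 * α) := by positivity
      linarith)
  have hE : errorSum m a α t ≤ ENNReal.ofReal (K * R) := by
    refine (errorSum_le hm.le ha (by linarith) hα hmα ht0 ht1).trans ?_
    have e1 : (m * α - 1) / (2 * α) = 1 := by
      rw [div_eq_one_iff_eq (by positivity)]
      linarith
    have e2 : t * Real.log (t ^ (-(1 / (2 * α)))) = 1 / (2 * α) * R := by
      rw [Real.log_rpow ht0, hR, one_div t, Real.log_inv]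
      ring
    have e3 : 0 ≤ 1 / (2 * α) * R := by positivity
    rw [hq, lintegral_Ioc_one_inv hT1, e1, Real.rpow_one, ← ENNReal.ofReal_mul ht0.le, e2,
      ← ENNReal.ofReal_add ht0.le e3, ← ENNReal.ofReal_add (by positivity) (by positivity)]
    apply ENNReal.ofReal_le_ofReal
    calc t + 1 / (2 * α) * R + (((m : ℝ) - 1) * α - 1)⁻¹ * t
        ≤ R + 1 / (2 * α) * R + (((m : ℝ) - 1) * α - 1)⁻¹ * R := by gcongr
      _ = K * R := by rw [hK]; ring
  have h3 := hmain t (K * R) ht0 (by positivity) hE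
  rw [Real.norm_eq_abs, Real.norm_of_nonneg hRpos.le]
  calc _ ≤ C * (K * R + t) := h3
    _ ≤ C * (K * R + R) := by gcongr
    _ = _ := by ring

/-- Here the sum of `radius ^ (m - 2)` converges, so the second entry of the minimum alone bounds
`errorSum` by a multiple of `t` and no splitting is needed. -/
theorem heatLoss_asymptotics_of_fast_decay (hm : 2 < m) {a α : ℝ} (ha : 0 < a)
    (ha' : a ≤ 1 / 4) (z : ℕ+ ≃ (Fin m → ℤ)) (h2 : 1 / ((m : ℝ) - 2) < α) :
    volume (ballUnion a α z) < ⊤ ∧ (∀ t : ℝ, 0 < t → heatContent (ballUnion a α z) t < ⊤) ∧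
      perimeter (ballUnion a α z) < ⊤ ∧
      (fun t : ℝ => heatLoss (ballUnion a α z) t
          - Real.pi ^ (-(1 / 2) : ℝ) * (perimeter (ballUnion a α z)).toReal * t ^ (1 / 2 : ℝ))
        =O[𝓝[>] 0] (fun t : ℝ => t) := by
  have hm2 : (0 : ℝ) < (m : ℝ) - 2 := by
    have : (2 : ℝ) < m := by exact_mod_cast hm
    linarith
  have h1 : 1 / ((m : ℝ) - 1) < α := lt_trans (by gcongr; linarith) h2
  obtain ⟨hvol, hH, hper, C, hC, hmain⟩ := exists_heatLoss_sub_perimeter_le hm.le ha ha' z h1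
  set S := ∑' i : ℕ+, ENNReal.ofReal (1 * radius a α (i : ℕ) ^ (m - 2)) with hS
  have hSfin : S < ⊤ := by
    apply tsum_radius_pow_lt_top
    rw [Nat.cast_sub hm.le, Nat.cast_ofNat]
    rwa [div_lt_iff₀ hm2, mul_comm] at h2
  refine ⟨hvol, hH, hper, IsBigO.of_bound (C * (S.toReal + 1)) ?_⟩
  filter_upwards [self_mem_nhdsWithin] with t ht
  have ht0 : 0 < t := ht
  have hE : errorSum m a α t ≤ ENNReal.ofReal (S.toReal * t) := by
    rw [ENNReal.ofReal_mul ENNReal.toReal_nonneg, ENNReal.ofReal_toReal hSfin.ne, hS,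
      ← ENNReal.tsum_mul_right]
    refine ENNReal.tsum_le_tsum fun i => ?_
    have := radius_pos (α := α) ha (pnat_cast_pos i)
    rw [← ENNReal.ofReal_mul (by positivity), one_mul]
    exact ENNReal.ofReal_le_ofReal (min_le_right _ _)
  have h3 := hmain t (S.toReal * t) ht0 (by positivity) hE
  rw [Real.norm_eq_abs, Real.norm_of_nonneg ht0.le]
  calc _ ≤ C * (S.toReal * t + t) := h3
    _ = _ := by ring

end HeatContent

end

/-! ### Assembly of the five cases -/

theorem theorem4 (m : ℕ) (hm : 2 ≤ m) (a α : ℝ) (ha : 0 < a) (ha' : a ≤ 1 / 4)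
    (z : ℕ+ ≃ (Fin m → ℤ)) (Ω : Set (HeatContent.E m)) (hΩ : Ω = HeatContent.ballUnion a α z) :
    (1 / (2 * (m : ℝ)) < α → α < 1 / (m : ℝ) →
      (∀ t : ℝ, 0 < t → HeatContent.heatContent Ω t < ⊤) ∧
      HeatContent.innerIntegral m α < ⊤ ∧
      (fun t : ℝ => (HeatContent.heatContent Ω t).toReal
          - HeatContent.cConst m a α * t ^ ((m * α - 1) / (2 * α)))
        =O[𝓝[>] 0] (fun _ : ℝ => (1 : ℝ))) ∧
    (1 / (m : ℝ) < α → α < 1 / ((m : ℝ) - 1) →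
      volume Ω < ⊤ ∧ (∀ t : ℝ, 0 < t → HeatContent.heatContent Ω t < ⊤) ∧
      HeatContent.outerIntegral m α < ⊤ ∧
      (fun t : ℝ => HeatContent.heatLoss Ω t
          - HeatContent.dConst m a α * t ^ ((m * α - 1) / (2 * α)))
        =O[𝓝[>] 0] (fun t : ℝ => t ^ (1 / 2 : ℝ))) ∧
    ((2 < m ∧ 1 / ((m : ℝ) - 1) < α ∧ α < 1 / ((m : ℝ) - 2)) ∨
        (m = 2 ∧ 1 / ((m : ℝ) - 1) < α) →
      volume Ω < ⊤ ∧ (∀ t : ℝ, 0 < t → HeatContent.heatContent Ω t < ⊤) ∧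
      HeatContent.perimeter Ω < ⊤ ∧
      (fun t : ℝ => HeatContent.heatLoss Ω t
          - Real.pi ^ (-(1 / 2) : ℝ) * (HeatContent.perimeter Ω).toReal * t ^ (1 / 2 : ℝ))
        =O[𝓝[>] 0] (fun t : ℝ => t ^ ((m * α - 1) / (2 * α)))) ∧
    (2 < m → α = 1 / ((m : ℝ) - 2) →
      volume Ω < ⊤ ∧ (∀ t : ℝ, 0 < t → HeatContent.heatContent Ω t < ⊤) ∧
      HeatContent.perimeter Ω < ⊤ ∧
      (fun t : ℝ => HeatContent.heatLoss Ω t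
          - Real.pi ^ (-(1 / 2) : ℝ) * (HeatContent.perimeter Ω).toReal * t ^ (1 / 2 : ℝ))
        =O[𝓝[>] 0] (fun t : ℝ => t * Real.log (1 / t))) ∧
    (2 < m → 1 / ((m : ℝ) - 2) < α →
      volume Ω < ⊤ ∧ (∀ t : ℝ, 0 < t → HeatContent.heatContent Ω t < ⊤) ∧
      HeatContent.perimeter Ω < ⊤ ∧
      (fun t : ℝ => HeatContent.heatLoss Ω t
          - Real.pi ^ (-(1 / 2) : ℝ) * (HeatContent.perimeter Ω).toReal * t ^ (1 / 2 : ℝ))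
        =O[𝓝[>] 0] (fun t : ℝ => t)) := by
  subst hΩ
  have hm' : (2 : ℝ) ≤ m := by exact_mod_cast hm
  refine ⟨fun h1 h2 => HeatContent.heatContent_asymptotics (by omega) ha ha' z h1 h2,
    fun h1 h2 => HeatContent.heatLoss_asymptotics_of_infinite_perimeter hm ha ha' z h1 h2,
    ?_,
    fun h2 h3 => HeatContent.heatLoss_asymptotics_of_critical_decay h2 ha ha' z h3,
    fun h2 h3 => HeatContent.heatLoss_asymptotics_of_fast_decay h2 ha ha' z h3⟩
  rintro (⟨h2, h1, h3⟩ | ⟨rfl, h1⟩)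
  · refine HeatContent.heatLoss_asymptotics_of_slow_decay hm ha ha' z h1 ?_
    have : (2 : ℝ) < m := by exact_mod_cast h2
    rwa [lt_div_iff₀ (by linarith), mul_comm] at h3
  · refine HeatContent.heatLoss_asymptotics_of_slow_decay hm ha ha' z h1 ?_
    -- In dimension two the slow-decay condition reads `0 * α < 1`, so it holds for every `α`.
    norm_num
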